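/- Consider the problem Connected Secluded Regular Subgraph: given a finite simple undirected graph $G$ with $n$ vertices, a weight function $\omega\colon V(G)\to\mathbb{Z}_{>0}$, a nonnegative integer $t$, and positive integers $w$ and $d$, decide whether there is a set $U\subseteq V(G)$ such that the induced subgraph $G[U]$ is connected and $d$-regular, $|N_G(U)|\le t$ (that is, $G[U]$ is $t$-secluded), and $\omega(U)=\sum_{v\in U}\omega(v)\ge w$. Here $N_G(U)$ is the set of vertices outside $U$ that have a neighbor in $U$. **Theorem.** Connected Secluded Regular Subgraph can be solved in time $2^{\mathcal{O}(t\log(td))}\cdot n^{\mathcal{O}(1)}$. Precisely: there are a single deterministic algorithm and a constant $C$ such that, for every instance $(G,\omega,t,w,d)$, the algorithm halts after at most $$C\cdot 2^{C\,t\log_2(td)}\cdot (n+1)^{C}$$ steps (where $t\log_2(td)$ is read as $0$ for $t=0$), correctly reports whether a set $U$ as above exists, and outputs such a set if there is one. The steps are those of a unit-cost random access machine on natural numbers whose arithmetic operations are addition and truncated subtraction, and whose input consists of $n,t,w,d$, the $n$ weights and the adjacency matrix of $G$. -/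

import Mathlib

/-! A random access machine with unit cost.  The registers and the memory cells hold natural
numbers; the arithmetic operations are addition and truncated subtraction. There is no
multiplication, so that this machine is polynomially equivalent to Turing machines. -/

namespace RAM

/-- A state of the machine: the contents of the registers and of the memory cells. -/
structure State where
  reg : ℕ → ℕ
  mem : ℕ → ℕ

/-- The elementary instructions, each of which takes one step. -/
inductive Instr where
  /-- Register `i` receives the constant `c`. -/
  | const (i c : ℕ)
  /-- Register `i` receives the sum of the registers `j` and `k`. -/
  | add (i j k : ℕ)
  /-- Register `i` receives the truncated difference of the registers `j` and `k`. -/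
  | sub (i j k : ℕ)
  /-- Register `i` receives the content of the memory cell whose address is in register `j`. -/
  | load (i j : ℕ)
  /-- The memory cell whose address is in register `i` receives the content of register `j`. -/
  | store (i j : ℕ)

/-- The effect of an elementary instruction. -/
def Instr.apply : Instr → State → State
  | .const i c, s => { s with reg := Function.update s.reg i c }
  | .add i j k, s => { s with reg := Function.update s.reg i (s.reg j + s.reg k) }
  | .sub i j k, s => { s with reg := Function.update s.reg i (s.reg j - s.reg k) }
  | .load i j, s => { s with reg := Function.update s.reg i (s.mem (s.reg j)) }
  | .store i j, s => { s with mem := Function.update s.mem (s.reg i) (s.reg j) }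

/-- Programs. The tests compare two registers: `ite i j P Q` runs `P` if register `i` is smaller
than register `j`, and `Q` otherwise; `loop i j P` repeats `P` while register `i` is smaller than
register `j`. -/
inductive Program where
  | skip
  | instr (a : Instr)
  | seq (P Q : Program)
  | ite (i j : ℕ) (P Q : Program)
  | loop (i j : ℕ) (P : Program)

/-- `Exec P s k s'`: started in the state `s`, the program `P` halts in the state `s'` after exactly
`k` steps, where every executed elementary instruction and every evaluated test is one step. -/
inductive Exec : Program → State → ℕ → State → Prop where
  | skip (s : State) : Exec .skip s 0 s
  | instr (a : Instr) (s : State) : Exec (.instr a) s 1 (a.apply s)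
  | seq {P Q : Program} {s s' s'' : State} {k l : ℕ} (hP : Exec P s k s') (hQ : Exec Q s' l s'') :
      Exec (.seq P Q) s (k + l) s''
  | ite_true {i j : ℕ} {P Q : Program} {s s' : State} {k : ℕ} (h : s.reg i < s.reg j)
      (hP : Exec P s k s') : Exec (.ite i j P Q) s (k + 1) s'
  | ite_false {i j : ℕ} {P Q : Program} {s s' : State} {k : ℕ} (h : ¬ s.reg i < s.reg j)
      (hQ : Exec Q s k s') : Exec (.ite i j P Q) s (k + 1) s'
  | loop_true {i j : ℕ} {P : Program} {s s' s'' : State} {k l : ℕ} (h : s.reg i < s.reg j)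
      (hP : Exec P s k s') (hL : Exec (.loop i j P) s' l s'') :
      Exec (.loop i j P) s (k + l + 1) s''
  | loop_false {i j : ℕ} {P : Program} {s : State} (h : ¬ s.reg i < s.reg j) :
      Exec (.loop i j P) s 1 s

/-- A program has at most one halting execution from a given state, so the number of steps and the
final state are those of the machine. -/
theorem Exec.deterministic {P : Program} {s s₁ s₂ : State} {k₁ k₂ : ℕ}
    (h₁ : Exec P s k₁ s₁) (h₂ : Exec P s k₂ s₂) : k₁ = k₂ ∧ s₁ = s₂ := by
  induction h₁ generalizing k₂ s₂ with
  | skip s => cases h₂; exact ⟨rfl, rfl⟩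
  | instr a s => cases h₂; exact ⟨rfl, rfl⟩
  | seq _ _ ihP ihQ =>
    cases h₂ with
    | seq hP hQ =>
      obtain ⟨rfl, rfl⟩ := ihP hP
      obtain ⟨rfl, rfl⟩ := ihQ hQ
      exact ⟨rfl, rfl⟩
  | ite_true h _ ih =>
    cases h₂ with
    | ite_true _ hP =>
      obtain ⟨rfl, rfl⟩ := ih hP
      exact ⟨rfl, rfl⟩
    | ite_false h' _ => exact absurd h h'
  | ite_false h _ ih =>
    cases h₂ with
    | ite_true h' _ => exact absurd h' h
    | ite_false _ hP =>
      obtain ⟨rfl, rfl⟩ := ih hP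
      exact ⟨rfl, rfl⟩
  | loop_true h _ _ ihP ihL =>
    cases h₂ with
    | loop_true _ hP hL =>
      obtain ⟨rfl, rfl⟩ := ihP hP
      obtain ⟨rfl, rfl⟩ := ihL hL
      exact ⟨rfl, rfl⟩
    | loop_false h' => exact absurd h h'
  | loop_false h =>
    cases h₂ with
    | loop_true h' _ _ => exact absurd h' h
    | loop_false _ => exact ⟨rfl, rfl⟩

end RAM

/-- The open neighborhood of a set `U` of vertices: the vertices outside `U` that have a neighbor
in `U`. -/
def SimpleGraph.openNbhd {V : Type*} (G : SimpleGraph V) (U : Set V) : Set V :=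
  (⋃ v ∈ U, G.neighborSet v) \ U

/-- A set `U` of vertices (or the subgraph that it induces) is `t`-secluded if its open
neighborhood has at most `t` vertices. -/
def SimpleGraph.IsSecluded {V : Type*} [Finite V] (G : SimpleGraph V) (t : ℕ) (U : Set V) : Prop :=
  (G.openNbhd U).ncard ≤ t

/-- The instances of Connected Secluded Regular Subgraph: a graph with `n` vertices, positive
integer vertex weights, a nonnegative integer `t` and positive integers `w` and `d`. -/
structure CSRSInstance where
  n : ℕ
  G : SimpleGraph (Fin n)
  ω : Fin n → ℕ
  t : ℕ
  w : ℕ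
  d : ℕ
  ω_pos : ∀ v, 0 < ω v
  w_pos : 0 < w
  d_pos : 0 < d

namespace CSRSInstance

open Classical in
/-- `U` is a solution: `U` induces a connected `t`-secluded `d`-regular subgraph of weight at
least `w`. -/
def IsSolution (I : CSRSInstance) (U : Finset (Fin I.n)) : Prop :=
  (I.G.induce (U : Set (Fin I.n))).Connected ∧
  I.G.IsSecluded I.t (U : Set (Fin I.n)) ∧
  (I.G.induce (U : Set (Fin I.n))).IsRegularOfDegree I.d ∧
  I.w ≤ ∑ v ∈ U, I.ω v

open Classical in
/-- The input as a list of numbers: `n`, `t`, `w`, `d`, then the `n` weights, then the rows of the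
adjacency matrix. -/
noncomputable def input (I : CSRSInstance) : List ℕ :=
  [I.n, I.t, I.w, I.d] ++ List.ofFn I.ω ++
    (List.ofFn fun i => List.ofFn fun j => if I.G.Adj i j then 1 else 0).flatten

/-- The initial state: the input stands in the memory cells `0, 1, 2, …`; everything else is `0`. -/
noncomputable def initialState (I : CSRSInstance) : RAM.State where
  reg := fun _ => 0
  mem := fun a => I.input.getD a 0

/-- The vertex set described by a final state: register `1` holds the address of the first of `n`
consecutive memory cells, and a vertex belongs to the set if its cell contains `1`. -/
def outputSet (I : CSRSInstance) (s : RAM.State) : Finset (Fin I.n) :=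
  Finset.univ.filter fun v => s.mem (s.reg 1 + v) = 1

/-- The final state `s` answers the instance correctly: register `0` holds `1` if there is a
solution and `0` otherwise, and in the first case the output set is a solution. -/
def CorrectAnswer (I : CSRSInstance) (s : RAM.State) : Prop :=
  ((∃ U, I.IsSolution U) → s.reg 0 = 1 ∧ I.IsSolution (I.outputSet s)) ∧
  ((¬ ∃ U, I.IsSolution U) → s.reg 0 = 0)

end CSRSInstance

/-! The algorithm is a bounded search whose branchings are replaced by an enumeration. Let `U` be a
solution and start from one of its vertices. Grow a set of chosen vertices inside `U`; every other
vertex is undecided or removed, and removed vertices lie in the neighborhood of `U`. A chosen vertex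
`x` has exactly `d` neighbors in `U`, all of them chosen or undecided. If `x` has at most `d` chosen
and undecided neighbors together, they all belong to `U`, and one of the undecided ones is chosen
without guessing (`Guided.treat_of_le`). Otherwise some undecided neighbor lies outside `U`. Those
before the first such neighbor lie in `U`, so there are at most `d` of them: its rank is one of `d +
1` values, and guessing it removes a neighbor of `U` (`Guided.treat_of_lt`). Hence at most `t`
guesses are made (`Guided.le`). Once no chosen vertex has an undecided neighbor, connectedness of
`U` makes the chosen set equal to `U` (`exists_search_accepts`).

The program tries every start vertex with every vector of `t` guesses, enumerated as the digits of
the numbers below `(d + 1) ^ t`. Wrong guesses do no harm: the chosen set is always connected, there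
are never more removed vertices than guesses, and the final test checks everything else
(`isSolution_of_accepts`). Each search takes polynomial time, and `pow_mul_le` puts the number of
vectors into the required form.

The program is compared with the functional model `search`, about which all combinatorial statements
are made. -/

namespace RAM

/-! ### Reasoning about executions with step counts -/

/-- `Run P s Q`: the program `P` halts when started in `s`, and the number of steps and the final
state satisfy `Q`. -/
def Run (P : Program) (s : State) (Q : ℕ → State → Prop) : Prop :=
  ∃ k s', Exec P s k s' ∧ Q k s'

theorem Run.mono {P : Program} {s : State} {Q Q' : ℕ → State → Prop} (h : Run P s Q)
    (hQ : ∀ k s', Q k s' → Q' k s') : Run P s Q' := by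
  obtain ⟨k, s', h1, h2⟩ := h
  exact ⟨k, s', h1, hQ _ _ h2⟩

/-- Being equivalences, these rules let `simp` execute straight-line code symbolically. -/
theorem run_skip {s : State} {Q : ℕ → State → Prop} : Run .skip s Q ↔ Q 0 s := by
  constructor
  · rintro ⟨k, s', h, hQ⟩
    cases h
    exact hQ
  · exact fun h => ⟨_, _, .skip s, h⟩

theorem run_instr {a : Instr} {s : State} {Q : ℕ → State → Prop} :
    Run (.instr a) s Q ↔ Q 1 (a.apply s) := by
  constructor
  · rintro ⟨k, s', h, hQ⟩
    cases h
    exact hQ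
  · exact fun h => ⟨_, _, .instr a s, h⟩

theorem run_seq {P P' : Program} {s : State} {Q : ℕ → State → Prop} :
    Run (.seq P P') s Q ↔ Run P s fun k s' => Run P' s' fun l s'' => Q (k + l) s'' := by
  constructor
  · rintro ⟨k, s', h, hQ⟩
    cases h with
    | seq h1 h2 => exact ⟨_, _, h1, _, _, h2, hQ⟩
  · rintro ⟨k, s', h1, l, s'', h2, hQ⟩
    exact ⟨_, _, .seq h1 h2, hQ⟩

theorem run_ite {i j : ℕ} {P P' : Program} {s : State} {Q : ℕ → State → Prop} :
    Run (.ite i j P P') s Q ↔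
      if s.reg i < s.reg j then Run P s fun k s' => Q (k + 1) s'
      else Run P' s fun k s' => Q (k + 1) s' := by
  constructor
  · rintro ⟨k, s', h, hQ⟩
    cases h with
    | ite_true h h1 => rw [if_pos h]; exact ⟨_, _, h1, hQ⟩
    | ite_false h h1 => rw [if_neg h]; exact ⟨_, _, h1, hQ⟩
  · split_ifs with h
    · rintro ⟨k, s', h1, hQ⟩
      exact ⟨_, _, .ite_true h h1, hQ⟩
    · rintro ⟨k, s', h1, hQ⟩
      exact ⟨_, _, .ite_false h h1, hQ⟩

/-- A loop whose body is executed `N - m` times, with at most `T` steps each. -/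
theorem run_loop_aux {i j : ℕ} {P : Program} (N T : ℕ) (Inv : ℕ → State → Prop)
    (hbody : ∀ m s, m < N → Inv m s →
      s.reg i < s.reg j ∧ Run P s fun k s' => k ≤ T ∧ Inv (m + 1) s')
    (hend : ∀ s, Inv N s → ¬ s.reg i < s.reg j) (r : ℕ) :
    ∀ m s, m + r = N → Inv m s →
      Run (.loop i j P) s fun k s' => k ≤ r * (T + 1) + 1 ∧ Inv N s' := by
  induction r with
  | zero =>
    intro m s hm h
    obtain rfl : m = N := by omega
    exact ⟨_, _, .loop_false (hend s h), by omega, h⟩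
  | succ r ih =>
    intro m s hm h
    obtain ⟨hlt, k, s', he, hk, hi⟩ := hbody m s (by omega) h
    obtain ⟨l, s'', he', hl, hi'⟩ := ih (m + 1) s' (by omega) hi
    refine ⟨_, _, .loop_true hlt he he', ?_, hi'⟩
    have : (r + 1) * (T + 1) = r * (T + 1) + (T + 1) := by ring
    omega

theorem run_loop {i j : ℕ} {P : Program} {s : State} (N T : ℕ) (Inv : ℕ → State → Prop)
    (h0 : Inv 0 s)
    (hbody : ∀ m s, m < N → Inv m s →
      s.reg i < s.reg j ∧ Run P s fun k s' => k ≤ T ∧ Inv (m + 1) s')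
    (hend : ∀ s, Inv N s → ¬ s.reg i < s.reg j) :
    Run (.loop i j P) s fun k s' => k ≤ N * (T + 1) + 1 ∧ Inv N s' :=
  run_loop_aux N T Inv hbody hend N 0 s (by omega) h0

/-- `P` is executed if the registers `i` and `j` are equal. -/
def Program.ifEq (i j : ℕ) (P : Program) : Program := .ite i j .skip (.ite j i .skip P)

/-- For unequal registers the number of tests, one or two, depends on which register is smaller; the
postcondition is therefore required for both counts. -/
theorem run_ifEq {i j : ℕ} {P : Program} {s : State} {Q : ℕ → State → Prop}
    (h : if s.reg i = s.reg j then Run P s fun k s' => Q (k + 2) s' else Q 1 s ∧ Q 2 s) :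
    Run (.ifEq i j P) s Q := by
  rw [Program.ifEq, run_ite]
  split_ifs at h with h1
  · rw [if_neg (by omega), run_ite, if_neg (by omega)]
    exact h
  · split_ifs with h2
    · rw [run_skip]; exact h.1
    · rw [run_ite, if_pos (by omega), run_skip]; exact h.2

end RAM

/-! ### Memory layout and registers -/

namespace CSRSInstance

variable (I : CSRSInstance)

/-- Adjacency, for vertices given as natural numbers. -/
def Adj (x y : ℕ) : Prop := ∃ (hx : x < I.n) (hy : y < I.n), I.G.Adj ⟨x, hx⟩ ⟨y, hy⟩

/-- The weight of a vertex given as a natural number. -/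
def wt (x : ℕ) : ℕ := if h : x < I.n then I.ω ⟨x, h⟩ else 0

/-- The length of the input. -/
def base : ℕ := 4 + I.n + I.n * I.n

/-- The memory that holds the input, followed by the array `S` of length `n` and the infinite
array `c`. -/
noncomputable def memory (S c : ℕ → ℕ) (a : ℕ) : ℕ :=
  if a < I.base then I.input.getD a 0 else if a < I.base + I.n then S (a - I.base)
  else c (a - I.base - I.n)

theorem length_input : I.input.length = I.base := by
  simp [input, base, Function.comp_def]
  ring

theorem initialState_mem : I.initialState.mem = I.memory 0 0 := by
  funext a
  simp only [initialState, memory]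
  split_ifs with h h'
  · rfl
  · exact List.getD_eq_default _ _ (by rw [length_input]; omega)
  · exact List.getD_eq_default _ _ (by rw [length_input]; omega)

variable {I} {S c : ℕ → ℕ}

theorem memory_zero : I.memory S c 0 = I.n := by
  simp [memory, base, input]

theorem memory_one : I.memory S c 1 = I.t := by
  rw [memory, if_pos (by simp only [base]; omega)]
  simp [input]

theorem memory_two : I.memory S c 2 = I.w := by
  rw [memory, if_pos (by simp only [base]; omega)]
  simp [input]

theorem memory_three : I.memory S c 3 = I.d := by
  rw [memory, if_pos (by simp only [base]; omega)]
  simp [input]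

theorem memory_wt {x : ℕ} (hx : x < I.n) : I.memory S c (4 + x) = I.wt x := by
  rw [memory, if_pos (by simp only [base]; omega), input, wt, dif_pos hx, List.append_assoc,
    List.getD_append_right _ _ _ _ (by simp), List.getD_append _ _ _ _ (by simpa using hx)]
  simp [hx]

open Classical in
theorem memory_adj {x y : ℕ} (hx : x < I.n) (hy : y < I.n) :
    I.memory S c (4 + I.n + x * I.n + y) = if I.Adj x y then 1 else 0 := by
  have hlt : x * I.n + y < I.n * I.n := by nlinarith
  rw [memory, if_pos (by simp only [base]; omega), input,
    List.getD_append_right _ _ _ _ (by simp; omega)]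
  have hl : (([I.n, I.t, I.w, I.d] ++ List.ofFn I.ω).length) = 4 + I.n := by simp; omega
  rw [hl, show 4 + I.n + x * I.n + y - (4 + I.n) = x * I.n + y by omega]
  -- The flattened matrix is a single list whose entry `k` belongs to row `k / n` and column `k %
  -- n`.
  have key : (List.ofFn fun i => List.ofFn fun j => if I.G.Adj i j then 1 else 0).flatten =
      List.ofFn fun k : Fin (I.n * I.n) => if I.Adj (k / I.n) (k % I.n) then 1 else 0 := by
    rw [List.ofFn_mul]
    congr 2
    funext i
    congr 1
    funext j
    have hn : 0 < I.n := j.pos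
    have h1 : (i * I.n + j : ℕ) / I.n = i := by
      rw [Nat.add_comm, Nat.add_mul_div_right _ _ hn, Nat.div_eq_of_lt j.2, Nat.zero_add]
    have h2 : (i * I.n + j : ℕ) % I.n = j := by
      rw [Nat.add_comm, Nat.add_mul_mod_self_right, Nat.mod_eq_of_lt j.2]
    simp [h1, h2, Adj]
  have hn : 0 < I.n := by omega
  have h1 : (x * I.n + y : ℕ) / I.n = x := by
    rw [Nat.add_comm, Nat.add_mul_div_right _ _ hn, Nat.div_eq_of_lt hy, Nat.zero_add]
  have h2 : (x * I.n + y : ℕ) % I.n = y := by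
    rw [Nat.add_comm, Nat.add_mul_mod_self_right, Nat.mod_eq_of_lt hy]
  rw [key, List.getD_eq_getElem _ _ (by simpa using hlt)]
  simp [h1, h2]

theorem memory_base {y : ℕ} (hy : y < I.n) : I.memory S c (I.base + y) = S y := by
  rw [memory, if_neg (by omega), if_pos (by omega)]
  congr 1; omega

theorem memory_choice (i : ℕ) : I.memory S c (I.base + I.n + i) = c i := by
  rw [memory, if_neg (by omega), if_neg (by omega)]
  congr 1; omega

theorem update_memory_base {y v : ℕ} (hy : y < I.n) :
    Function.update (I.memory S c) (I.base + y) v = I.memory (Function.update S y v) c := by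
  funext a
  simp only [Function.update_apply, memory]
  split_ifs <;> first | rfl | omega

theorem update_memory_choice {i v : ℕ} :
    Function.update (I.memory S c) (I.base + I.n + i) v = I.memory S (Function.update c i v) := by
  funext a
  simp only [Function.update_apply, memory]
  split_ifs <;> first | rfl | omega

/-- The contents of the registers that the program changes after its initialization. -/
structure Vars where
  found : ℕ
  v : ℕ
  rnd : ℕ
  x : ℕ
  p : ℕ
  y : ℕ
  tmp : ℕ
  e : ℕ
  a : ℕ
  b : ℕ
  i : ℕ
  k : ℕ
  val : ℕ
  q : ℕ
  bad : ℕ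
  W : ℕ
  f : ℕ

/-- Assignment to a register. -/
def Vars.set (r : Vars) (u : ℕ) : ℕ → Vars
  | 0 => { r with found := u }
  | 12 => { r with v := u }
  | 13 => { r with rnd := u }
  | 14 => { r with x := u }
  | 15 => { r with p := u }
  | 16 => { r with y := u }
  | 17 => { r with tmp := u }
  | 18 => { r with e := u }
  | 19 => { r with a := u }
  | 20 => { r with b := u }
  | 21 => { r with i := u }
  | 22 => { r with k := u }
  | 23 => { r with val := u }
  | 24 => { r with q := u }
  | 25 => { r with bad := u }
  | 26 => { r with W := u }
  | 27 => { r with f := u }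
  | _ => r

variable (I) in
/-- The contents of all registers after the initialization. -/
def regs (r : Vars) : ℕ → ℕ
  | 0 => r.found
  | 1 => I.base
  | 2 => I.n
  | 3 => I.t
  | 4 => I.w
  | 5 => I.d
  | 7 => 1
  | 8 => 2
  | 9 => 4
  | 10 => 4 + I.n
  | 11 => I.base + I.n
  | 12 => r.v
  | 13 => r.rnd
  | 14 => r.x
  | 15 => r.p
  | 16 => r.y
  | 17 => r.tmp
  | 18 => r.e
  | 19 => r.a
  | 20 => r.b
  | 21 => r.i
  | 22 => r.k
  | 23 => r.val
  | 24 => r.q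
  | 25 => r.bad
  | 26 => r.W
  | 27 => r.f
  -- Register `6` is never written and serves as the constant zero.
  | _ => 0

variable (I) in
/-- The states of the program after its initialization. -/
noncomputable def st (r : Vars) (S c : ℕ → ℕ) : RAM.State := ⟨I.regs r, I.memory S c⟩

theorem st_reg (r : Vars) (j : ℕ) : (I.st r S c).reg j = I.regs r j := rfl

theorem update_regs (r : Vars) (u : ℕ) {j : ℕ} (hj : j = 0 ∨ 12 ≤ j ∧ j ≤ 27) :
    Function.update (I.regs r) j u = I.regs (r.set u j) := by
  have : j ∈ ({0, 12, 13, 14, 15, 16, 17, 18, 19, 20, 21, 22, 23, 24, 25, 26, 27} : Finset ℕ) := by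
    simp; omega
  funext l
  by_cases h : l = j
  · subst h
    rw [Function.update_self]
    fin_cases this <;> rfl
  · rw [Function.update_of_ne h]
    fin_cases this <;> dsimp only [Vars.set] <;> unfold regs <;> split <;> first | rfl | omega

theorem apply_const (r : Vars) (j u : ℕ) (hj : j = 0 ∨ 12 ≤ j ∧ j ≤ 27) :
    (RAM.Instr.const j u).apply (I.st r S c) = I.st (r.set u j) S c := by
  simp only [RAM.Instr.apply, st, update_regs r _ hj]

theorem apply_add (r : Vars) (j k l : ℕ) (hj : j = 0 ∨ 12 ≤ j ∧ j ≤ 27) :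
    (RAM.Instr.add j k l).apply (I.st r S c) = I.st (r.set (I.regs r k + I.regs r l) j) S c := by
  simp only [RAM.Instr.apply, st, update_regs r _ hj]

theorem apply_sub (r : Vars) (j k l : ℕ) (hj : j = 0 ∨ 12 ≤ j ∧ j ≤ 27) :
    (RAM.Instr.sub j k l).apply (I.st r S c) = I.st (r.set (I.regs r k - I.regs r l) j) S c := by
  simp only [RAM.Instr.apply, st, update_regs r _ hj]

theorem apply_load (r : Vars) (j k : ℕ) (hj : j = 0 ∨ 12 ≤ j ∧ j ≤ 27) :
    (RAM.Instr.load j k).apply (I.st r S c) =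
      I.st (r.set (I.memory S c (I.regs r k)) j) S c := by
  simp only [RAM.Instr.apply, st, update_regs r _ hj]

theorem apply_store_base (r : Vars) (j k y : ℕ) (hy : y < I.n) (h : I.regs r j = I.base + y) :
    (RAM.Instr.store j k).apply (I.st r S c) =
      I.st r (Function.update S y (I.regs r k)) c := by
  simp only [RAM.Instr.apply, st, h, update_memory_base hy]

theorem apply_store_choice (r : Vars) (j k i : ℕ) (h : I.regs r j = I.base + I.n + i) :
    (RAM.Instr.store j k).apply (I.st r S c) =
      I.st r S (Function.update c i (I.regs r k)) := by
  simp only [RAM.Instr.apply, st, h, update_memory_choice]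

open RAM RAM.Instr

instance : Coe RAM.Instr RAM.Program := ⟨RAM.Program.instr⟩

infixr:60 " ;; " => RAM.Program.seq

/-! ### Functional model of a search -/

section Model

open Classical

variable (I)

/-- The number of chosen neighbors of `x` below `m`. -/
noncomputable def chosenCount (S : ℕ → ℕ) (x m : ℕ) : ℕ :=
  Nat.count (fun y => I.Adj x y ∧ S y = 1) m

/-- The number of undecided neighbors of `x` below `m`. -/
noncomputable def undecidedCount (S : ℕ → ℕ) (x m : ℕ) : ℕ :=
  Nat.count (fun y => I.Adj x y ∧ S y = 0) m

/-- The label `u` is assigned to the undecided neighbor number `k` of `x` if it is below `m`. -/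
noncomputable def assign (S : ℕ → ℕ) (x k u m : ℕ) (y : ℕ) : ℕ :=
  if y < m ∧ (I.Adj x y ∧ S y = 0) ∧ I.undecidedCount S x y = k then u else S y

/-- The treatment of the vertex `x`. The labels are `0` for an undecided vertex, `1` for a chosen
vertex, and `2` for a removed vertex. -/
noncomputable def treat (c : ℕ → ℕ) (x : ℕ) (σ : (ℕ → ℕ) × ℕ) : (ℕ → ℕ) × ℕ :=
  if σ.1 x = 1 then
    -- The second component of `σ` counts the guesses made so far, and so is the index of the next
    -- unused entry of `c`.
    if I.d < I.chosenCount σ.1 x I.n + I.undecidedCount σ.1 x I.n then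
      (I.assign σ.1 x (c σ.2) 2 I.n, σ.2 + 1)
    else (I.assign σ.1 x 0 1 I.n, σ.2)
  else σ

/-- The treatment of the vertices of a list, one after the other. -/
noncomputable def treatList (c : ℕ → ℕ) (xs : List ℕ) (σ : (ℕ → ℕ) × ℕ) : (ℕ → ℕ) × ℕ :=
  xs.foldl (fun σ x => I.treat c x σ) σ

/-- The deviation from a `d`-regular subgraph without undecided neighbors, below `m`. -/
noncomputable def defect (S : ℕ → ℕ) (m : ℕ) : ℕ :=
  ∑ x ∈ Finset.range m, if S x = 1 then I.undecidedCount S x I.n +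
    (I.d - I.chosenCount S x I.n) + (I.chosenCount S x I.n - I.d) else 0

/-- The weight of the chosen vertices below `m`. -/
noncomputable def chosenWeight (S : ℕ → ℕ) (m : ℕ) : ℕ :=
  ∑ x ∈ Finset.range m, if S x = 1 then I.wt x else 0

/-- The labels with a single chosen vertex. -/
def start (v : ℕ) : ℕ → ℕ := Function.update 0 v 1

/-- The final state of a search. -/
noncomputable def search (c : ℕ → ℕ) (v : ℕ) : (ℕ → ℕ) × ℕ :=
  I.treatList c (List.replicate I.n (List.range I.n)).flatten (start v, 0)

/-- The test at the end of a search. -/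
def Accepts (σ : (ℕ → ℕ) × ℕ) : Prop :=
  I.defect σ.1 I.n = 0 ∧ σ.2 ≤ I.t ∧ I.w ≤ I.chosenWeight σ.1 I.n

end Model

/-! ### The programs compute the model -/

/-- `a` and `b` receive the numbers of chosen and of undecided neighbors of `x`. -/
def countProg : Program :=
  const 16 0 ;; const 19 0 ;; const 20 0 ;;
  .loop 16 2 (add 17 15 16 ;; load 17 17 ;;
    .ite 6 17 (add 17 1 16 ;; load 17 17 ;;
      .ite 17 7 (add 20 20 7) (.ite 17 8 (add 19 19 7) .skip)) .skip ;;
    add 16 16 7)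

theorem run_countProg (r : Vars) (hx : r.x < I.n) (hp : r.p = 4 + I.n + r.x * I.n) :
    Run countProg (I.st r S c) fun k s => k ≤ 12 * I.n + 12 ∧ ∃ y tmp, s = I.st { r with
      y := y, tmp := tmp, a := I.chosenCount S r.x I.n, b := I.undecidedCount S r.x I.n } S c := by
  classical
  simp only [countProg, run_seq, run_instr, apply_const, Nat.reduceLeDiff, or_true, and_self,
    Vars.set]
  -- The longest path through the body has 9 steps; the recursion of `Nat.count` mirrors the loop.
  refine (run_loop I.n 9 (fun m s => ∃ tmp, s = I.st { r with
      y := m, tmp := tmp, a := I.chosenCount S r.x m, b := I.undecidedCount S r.x m } S c)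
    ?_ ?_ ?_).mono ?_
  · exact ⟨r.tmp, by simp [chosenCount, undecidedCount]⟩
  · rintro m s hm ⟨tmp, rfl⟩
    refine ⟨hm, ?_⟩
    have hadj := memory_adj (S := S) (c := c) hx hm
    have hS := memory_base (S := S) (c := c) hm
    by_cases h : I.Adj r.x m
    · rw [if_pos h] at hadj
      rcases hv : S m with _ | _ | u
      all_goals simp [run_seq, run_instr, run_ite, run_skip, apply_add, apply_load,
        Vars.set, regs, st_reg, hp, hadj, hS, hv, h, chosenCount, undecidedCount, Nat.count_succ]
      all_goals exact ⟨_, rfl⟩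
    · rw [if_neg h] at hadj
      simp [run_seq, run_instr, run_ite, run_skip, apply_add, apply_load,
        Vars.set, regs, st_reg, hp, hadj, h, chosenCount, undecidedCount, Nat.count_succ]
      exact ⟨_, rfl⟩
  · rintro s ⟨tmp, rfl⟩
    simp [st_reg, regs]
  · rintro k s ⟨hk, tmp, rfl⟩
    exact ⟨by omega, _, _, rfl⟩

/-- The label `val` is assigned to the undecided neighbor number `k` of `x`. -/
def assignProg : Program :=
  const 16 0 ;; const 24 0 ;;
  .loop 16 2 (add 17 15 16 ;; load 17 17 ;;
    .ite 6 17 (add 17 1 16 ;; load 18 17 ;;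
      .ifEq 18 6 (.ifEq 24 22 (store 17 23) ;; add 24 24 7)) .skip ;;
    add 16 16 7)

theorem run_assignProg (r : Vars) (hx : r.x < I.n) (hp : r.p = 4 + I.n + r.x * I.n) :
    Run assignProg (I.st r S c) fun k s => k ≤ 16 * I.n + 16 ∧ ∃ y tmp e q, s = I.st { r with
      y := y, tmp := tmp, e := e, q := q } (I.assign S r.x r.k r.val I.n) c := by
  classical
  simp only [assignProg, run_seq, run_instr, apply_const, Nat.reduceLeDiff, or_true, and_self,
    Vars.set]
  refine (run_loop I.n 13 (fun m s => ∃ tmp e, s = I.st { r with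
      y := m, tmp := tmp, e := e, q := I.undecidedCount S r.x m }
      (I.assign S r.x r.k r.val m) c) ?_ ?_ ?_).mono ?_
  · refine ⟨r.tmp, r.e, ?_⟩
    have : I.assign S r.x r.k r.val 0 = S := by funext y; simp [assign]
    simp [undecidedCount, this]
  · rintro m s hm ⟨tmp, e, rfl⟩
    refine ⟨hm, ?_⟩
    have hadj := memory_adj (S := I.assign S r.x r.k r.val m) (c := c) hx hm
    have hS := memory_base (S := I.assign S r.x r.k r.val m) (c := c) hm
    -- Cell `m` still has its original label when it is visited, so `q` counts undecided neighbors
    -- with respect to the unmodified `S`.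
    rw [show I.assign S r.x r.k r.val m m = S m by simp [assign]] at hS
    have same (h : ¬ ((I.Adj r.x m ∧ S m = 0) ∧ I.undecidedCount S r.x m = r.k)) :
        I.assign S r.x r.k r.val (m + 1) = I.assign S r.x r.k r.val m := by
      funext y
      rcases lt_trichotomy y m with hy | rfl | hy
      · simp [assign, hy, Nat.lt_succ_of_lt hy]
      · simp only [assign]
        rw [if_neg (fun h' => h h'.2), if_neg (fun h' => h h'.2)]
      · simp [assign, show ¬ y < m by omega, show ¬ y < m + 1 by omega]
    by_cases h : I.Adj r.x m
    · rw [if_pos h] at hadj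
      by_cases hv : S m = 0
      · by_cases hk : I.undecidedCount S r.x m = r.k
        · have upd : I.assign S r.x r.k r.val (m + 1) =
              Function.update (I.assign S r.x r.k r.val m) m r.val := by
            funext y
            rcases lt_trichotomy y m with hy | rfl | hy
            · simp [assign, hy, Nat.lt_succ_of_lt hy, hy.ne]
            · simp [assign, h, hv, hk]
            · simp [assign, show ¬ y < m by omega, show ¬ y < m + 1 by omega, hy.ne']
          simp [run_seq, run_instr, run_ite, run_skip, apply_add, apply_load,
            Vars.set, regs, st_reg, hp, hadj, hS, hv, hk, upd]
          refine run_ifEq ?_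
          simp [run_seq, run_instr,
            regs, st_reg]
          refine run_ifEq ?_
          simp [st_reg, regs]
          rw [run_instr, apply_store_base _ _ _ m hm (by simp [regs])]
          simp [apply_add, Vars.set, regs]
          exact ⟨_, _, by simp [← hk, undecidedCount, Nat.count_succ, h, hv]; rfl⟩
        · simp [run_seq, run_instr, run_ite, run_skip, apply_add, apply_load,
            Vars.set, regs, st_reg, hp, hadj, hS, hv]
          refine run_ifEq ?_
          simp [run_seq, run_instr,
            regs, st_reg]
          refine run_ifEq ?_
          rw [same (by tauto)]
          simp [st_reg, regs, apply_add, hk, Vars.set]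
          exact ⟨_, _, by simp [undecidedCount, Nat.count_succ, h, hv]; rfl⟩
      · simp [run_seq, run_instr, run_ite, run_skip, apply_add, apply_load,
          Vars.set, regs, st_reg, hp, hadj, hS]
        refine run_ifEq ?_
        rw [same (by tauto)]
        simp [st_reg, regs, apply_add, hv, Vars.set]
        exact ⟨_, _, by simp [undecidedCount, Nat.count_succ, h, hv]; rfl⟩
    · rw [if_neg h] at hadj
      simp [run_seq, run_instr, run_ite, run_skip, apply_add, apply_load,
        Vars.set, regs, st_reg, hp, hadj, h, same, undecidedCount, Nat.count_succ]
      exact ⟨_, _, rfl⟩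
  · rintro s ⟨tmp, e, rfl⟩
    simp [st_reg, regs]
  · rintro k s ⟨hk, tmp, e, rfl⟩
    exact ⟨by omega, _, _, _, _, rfl⟩

/-- The treatment of the vertex `x`. -/
def treatProg : Program :=
  add 17 1 14 ;; load 17 17 ;;
  .ifEq 17 7 (countProg ;; add 17 19 20 ;;
    .ite 5 17 (add 17 11 21 ;; load 22 17 ;; const 23 2 ;; add 21 21 7)
      (const 22 0 ;; const 23 1) ;; assignProg)

theorem run_treatProg (r : Vars) (hx : r.x < I.n) (hp : r.p = 4 + I.n + r.x * I.n) :
    Run treatProg (I.st r S c) fun k s => k ≤ 28 * I.n + 50 ∧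
      ∃ r', s = I.st r' (I.treat c r.x (S, r.i)).1 c ∧ r'.i = (I.treat c r.x (S, r.i)).2 ∧
        r'.found = r.found ∧ r'.v = r.v ∧ r'.rnd = r.rnd ∧ r'.x = r.x ∧ r'.p = r.p := by
  have hS := memory_base (S := S) (c := c) hx
  simp [treatProg, run_seq, run_instr, apply_add, apply_load, Vars.set, regs, hS]
  refine run_ifEq ?_
  simp only [st_reg, regs]
  split_ifs with h
  · refine run_seq.2 ((run_countProg _ (by exact hx) (by exact hp)).mono ?_)
    rintro k s ⟨hk, y, tmp, rfl⟩
    simp only [run_seq, run_instr, run_ite, apply_add, apply_load, apply_const, Vars.set, regs,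
      st_reg, Nat.reduceLeDiff, or_true, and_self, memory_choice]
    split_ifs with hd
    all_goals
      refine (run_assignProg _ (by exact hx) (by exact hp)).mono ?_
      rintro l s ⟨hl, y, tmp, e, q, rfl⟩
      simp only [treat, h, hd, ↓reduceIte]
      exact ⟨by omega, _, rfl, rfl, rfl, rfl, rfl, rfl, rfl⟩
  · simp only [treat, h, ↓reduceIte]
    exact ⟨⟨by omega, _, rfl, rfl, rfl, rfl, rfl, rfl, rfl⟩,
      ⟨by omega, _, rfl, rfl, rfl, rfl, rfl, rfl, rfl⟩⟩

theorem treatList_range_succ (m : ℕ) (σ : (ℕ → ℕ) × ℕ) :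
    I.treatList c (List.range (m + 1)) σ = I.treat c m (I.treatList c (List.range m) σ) := by
  simp [treatList, List.range_succ, List.foldl_append]

/-- The treatment of all vertices. -/
def passProg : Program :=
  const 14 0 ;; add 15 10 6 ;;
  .loop 14 2 (treatProg ;; add 15 15 2 ;; add 14 14 7)

theorem run_passProg (r : Vars) :
    Run passProg (I.st r S c) fun k s => k ≤ 100 * (I.n + 1) ^ 2 ∧
      ∃ r', s = I.st r' (I.treatList c (List.range I.n) (S, r.i)).1 c ∧
        r'.i = (I.treatList c (List.range I.n) (S, r.i)).2 ∧
        r'.found = r.found ∧ r'.v = r.v ∧ r'.rnd = r.rnd := by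
  simp only [passProg, run_seq, run_instr, apply_const, apply_add, Nat.reduceLeDiff, or_true,
    and_self, Vars.set, regs]
  -- Without multiplication, the address `p` of row `m` of the matrix is maintained by adding `n` in
  -- every round.
  refine (run_loop I.n (28 * I.n + 52) (fun m s =>
      ∃ r', s = I.st r' (I.treatList c (List.range m) (S, r.i)).1 c ∧
        r'.i = (I.treatList c (List.range m) (S, r.i)).2 ∧
        r'.found = r.found ∧ r'.v = r.v ∧ r'.rnd = r.rnd ∧ r'.x = m ∧
        r'.p = 4 + I.n + m * I.n) ?_ ?_ ?_).mono ?_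
  · exact ⟨_, rfl, by simp [treatList]⟩
  · rintro m s hm ⟨r', rfl, h1, h2, h3, h4, h5, h6⟩
    refine ⟨by simpa [st_reg, regs, h5] using hm, ?_⟩
    refine run_seq.2 ((run_treatProg r' (by omega) (by rw [h6, h5])).mono ?_)
    rintro k s ⟨hk, r'', rfl, g1, g2, g3, g4, g5, g6⟩
    simp only [run_seq, run_instr, apply_add, Nat.reduceLeDiff, or_true, and_self, Vars.set, regs]
    rw [treatList_range_succ, ← h5, ← Prod.mk.eta (p := I.treatList c _ _), h5, ← h1, ← h5]
    exact ⟨by omega, _, rfl, by simp [*], by simp [*], by simp [*], by simp [*], by simp [*],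
      by simp [*]; ring⟩
  · rintro s ⟨r', rfl, h1, h2, h3, h4, h5, h6⟩
    simp [st_reg, regs, h5]
  · rintro k s ⟨hk, r', rfl, h1, h2, h3, h4, h5, h6⟩
    exact ⟨by nlinarith, r', rfl, h1, h2, h3, h4⟩

/-- Only the first `n` labels are stored in memory, so the values of `S` from `n` on are irrelevant
to the state. -/
theorem st_congr {r : Vars} {S' : ℕ → ℕ} (h : ∀ y < I.n, S y = S' y) :
    I.st r S c = I.st r S' c := by
  simp only [st, State.mk.injEq, true_and]
  funext a
  simp only [memory]
  split_ifs with h1 h2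
  · rfl
  · exact h _ (by omega)
  · rfl

/-- All vertices become undecided. -/
def clearProg : Program :=
  const 14 0 ;; .loop 14 2 (add 17 1 14 ;; store 17 6 ;; add 14 14 7)

theorem run_clearProg (r : Vars) :
    Run clearProg (I.st r S c) fun k s => k ≤ 4 * I.n + 2 ∧
      ∃ r', s = I.st r' 0 c ∧ r'.found = r.found ∧ r'.v = r.v := by
  simp only [clearProg, run_seq, run_instr, apply_const, Nat.reduceLeDiff, or_true, and_self,
    Vars.set]
  refine (run_loop I.n 3 (fun m s => ∃ tmp, s = I.st { r with x := m, tmp := tmp }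
    (fun y => if y < m then 0 else S y) c) ?_ ?_ ?_).mono ?_
  · exact ⟨r.tmp, by simp⟩
  · rintro m s hm ⟨tmp, rfl⟩
    refine ⟨hm, ?_⟩
    rw [run_seq, run_instr, apply_add _ _ _ _ (by omega)]
    rw [run_seq, run_instr, apply_store_base _ _ _ m hm (by simp [Vars.set, regs]), run_instr,
      apply_add _ _ _ _ (by omega)]
    refine ⟨by omega, I.base + m, ?_⟩
    simp only [Vars.set, regs]
    congr 1
    funext y
    simp only [Function.update_apply]
    split_ifs <;> first | rfl | omega
  · rintro s ⟨tmp, rfl⟩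
    simp [st_reg, regs]
  · rintro k s ⟨hk, tmp, rfl⟩
    exact ⟨by omega, _, st_congr (fun y hy => by simp [hy]), rfl, rfl⟩

/-- A search from the vertex `v`. -/
def searchProg : Program :=
  clearProg ;; add 17 1 12 ;; store 17 7 ;; const 21 0 ;; const 13 0 ;;
  .loop 13 2 (passProg ;; add 13 13 7)

theorem run_searchProg (r : Vars) (hv : r.v < I.n) :
    Run searchProg (I.st r S c) fun k s => k ≤ 120 * (I.n + 1) ^ 3 ∧
      ∃ r', s = I.st r' (I.search c r.v).1 c ∧ r'.i = (I.search c r.v).2 ∧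
        r'.found = r.found ∧ r'.v = r.v := by
  refine run_seq.2 ((run_clearProg r).mono ?_)
  rintro k s ⟨hk, r', rfl, h1, h2⟩
  rw [run_seq, run_instr, apply_add _ _ _ _ (by omega)]
  rw [run_seq, run_instr, apply_store_base _ _ _ r.v hv (by simp [Vars.set, regs, h2])]
  simp only [run_seq, run_instr, apply_const, Nat.reduceLeDiff, or_true, and_self, Vars.set, regs]
  refine (run_loop I.n (100 * (I.n + 1) ^ 2 + 1) (fun m s => ∃ r',
      s = I.st r' (I.treatList c (List.replicate m (List.range I.n)).flatten (start r.v, 0)).1 c ∧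
      r'.i = (I.treatList c (List.replicate m (List.range I.n)).flatten (start r.v, 0)).2 ∧
      r'.found = r.found ∧ r'.v = r.v ∧ r'.rnd = m) ?_ ?_ ?_).mono ?_
  · exact ⟨_, rfl, by simp [treatList], h1, h2, rfl⟩
  · rintro m s hm ⟨r', rfl, h1, h2, h3, h4⟩
    refine ⟨by simpa [st_reg, regs, h4] using hm, run_seq.2 ((run_passProg r').mono ?_)⟩
    rintro k s ⟨hk, r'', rfl, g1, g2, g3, g4⟩
    simp only [run_instr, apply_add, Nat.reduceLeDiff, or_true, and_self, Vars.set, regs]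
    have key : I.treatList c (List.replicate (m + 1) (List.range I.n)).flatten (start r.v, 0) =
        I.treatList c (List.range I.n) ((I.treatList c (List.replicate m (List.range I.n)).flatten
          (start r.v, 0)).1, r'.i) := by
      rw [h1, List.replicate_succ', List.flatten_append, treatList, List.foldl_append]
      simp [treatList]
    rw [key]
    exact ⟨by omega, _, rfl, by simp [*], by simp [*], by simp [*], by simp [*]⟩
  · rintro s ⟨r', rfl, h1, h2, h3, h4⟩
    simp [st_reg, regs, h4]
  · rintro l s ⟨hl, r', rfl, h1, h2, h3, h4⟩
    exact ⟨by nlinarith, r', rfl, h1, h2, h3⟩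

/-- The test at the end of a search. -/
def checkProg : Program :=
  const 25 0 ;; const 26 0 ;; const 14 0 ;; add 15 10 6 ;;
  .loop 14 2 (add 17 1 14 ;; load 17 17 ;;
    .ifEq 17 7 (countProg ;; add 25 25 20 ;; sub 17 5 19 ;; add 25 25 17 ;; sub 17 19 5 ;;
      add 25 25 17 ;; add 17 9 14 ;; load 17 17 ;; add 26 26 17) ;;
    add 15 15 2 ;; add 14 14 7) ;;
  .ite 25 7 (.ite 3 21 .skip (.ite 26 4 .skip (const 0 1))) .skip

open Classical in
theorem run_checkProg (r : Vars) :
    Run checkProg (I.st r S c) fun k s => k ≤ 50 * (I.n + 1) ^ 2 ∧ ∃ r', s = I.st r' S c ∧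
      r'.found = (if I.Accepts (S, r.i) then 1 else r.found) ∧ r'.v = r.v := by
  simp only [checkProg, run_seq, run_instr, apply_const, apply_add, Nat.reduceLeDiff, or_true,
    and_self, Vars.set, regs]
  refine (run_loop I.n (12 * I.n + 28) (fun m s => ∃ r', s = I.st r' S c ∧
      r'.bad = I.defect S m ∧ r'.W = I.chosenWeight S m ∧ r'.i = r.i ∧
      r'.found = r.found ∧ r'.v = r.v ∧ r'.x = m ∧
      r'.p = 4 + I.n + m * I.n) ?_ ?_ ?_).mono ?_
  · exact ⟨_, rfl, by simp [defect], by simp [chosenWeight], rfl, rfl, rfl, rfl, by simp⟩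
  · rintro m s hm ⟨r', rfl, h1, h2, h3, h4, h5, h6, h7⟩
    refine ⟨by simpa [st_reg, regs, h6] using hm, ?_⟩
    have hS := memory_base (S := S) (c := c) hm
    have hW := memory_wt (S := S) (c := c) hm
    simp only [run_seq, run_instr, apply_add, apply_load, Nat.reduceLeDiff, or_true, and_self,
      Vars.set, regs, h6, hS]
    refine run_ifEq ?_
    simp only [st_reg, regs]
    split_ifs with h
    · refine run_seq.2 ((run_countProg _ (by exact hm) (by exact h7)).mono ?_)
      rintro k s ⟨hk, y, tmp, rfl⟩
      simp only [run_seq, run_instr, apply_add, apply_sub, apply_load, Nat.reduceLeDiff, or_true,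
        and_self, Vars.set, regs, hW]
      refine ⟨by omega, _, rfl, ?_, ?_, h3, h4, h5, rfl, ?_⟩
      · simp [defect, Finset.sum_range_succ, h, h1]; ring
      · simp [chosenWeight, Finset.sum_range_succ, h, h2]
      · simp only [h7]; ring
    · simp only [apply_add, Nat.reduceLeDiff, or_true, and_self, Vars.set, regs]
      refine ⟨⟨by omega, _, rfl, ?_, ?_, h3, h4, h5, rfl, ?_⟩,
        ⟨by omega, _, rfl, ?_, ?_, h3, h4, h5, rfl, ?_⟩⟩
      any_goals simp [defect, Finset.sum_range_succ, h, h1]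
      any_goals simp [chosenWeight, Finset.sum_range_succ, h, h2]
      all_goals simp only [h7]; ring
  · rintro s ⟨r', rfl, h1, h2, h3, h4, h5, h6, h7⟩
    simp [st_reg, regs, h6]
  · rintro k s ⟨hk, r', rfl, h1, h2, h3, h4, h5, h6, h7⟩
    have hk' : k + 20 ≤ 50 * (I.n + 1) ^ 2 := by nlinarith
    have hA : I.Accepts (S, r.i) ↔
        I.defect S I.n < 1 ∧ ¬ I.t < r.i ∧ ¬ I.chosenWeight S I.n < I.w := by
      simp only [Accepts]
      omega
    simp only [run_ite, run_skip, run_instr, apply_const, st_reg, regs, h1, h2, h3, Vars.set,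
      Nat.reduceLeDiff, true_or]
    by_cases h : I.Accepts (S, r.i)
    · have h' := hA.1 h
      rw [if_pos h'.1, if_neg h'.2.1, if_neg h'.2.2]
      exact ⟨by omega, _, rfl, by rw [if_pos h], h5⟩
    · have h' := mt hA.2 h
      simp only [h, ↓reduceIte]
      split_ifs with g1 g2 g3
      · exact ⟨by omega, _, rfl, h4, h5⟩
      · exact ⟨by omega, _, rfl, h4, h5⟩
      · exact absurd ⟨g1, g2, g3⟩ h'
      · exact ⟨by omega, _, rfl, h4, h5⟩

/-- The searches from all vertices, until one of them is successful. -/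
def sweepProg : Program :=
  const 12 0 ;; .loop 12 2 (.ite 0 7 (searchProg ;; checkProg) .skip ;; add 12 12 7)

/-- The labels `S` are those at the end of a successful search. -/
def Witness (I : CSRSInstance) (S : ℕ → ℕ) : Prop :=
  ∃ c v, v < I.n ∧ (I.search c v).1 = S ∧ I.Accepts (I.search c v)

/-- After a success every further round is skipped, so the labels of the successful search survive
as the output. This is why the invariant carries `Witness`. -/
theorem run_sweepProg (r : Vars) (h : r.found = 0 ∨ r.found = 1 ∧ I.Witness S) :
    Run sweepProg (I.st r S c) fun k s => k ≤ 180 * (I.n + 1) ^ 4 ∧ ∃ r' S', s = I.st r' S' c ∧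
      (r'.found = 0 ∧ r.found = 0 ∧ (∀ v < I.n, ¬ I.Accepts (I.search c v)) ∨
        r'.found = 1 ∧ I.Witness S') := by
  simp only [sweepProg, run_seq, run_instr, apply_const, Nat.reduceLeDiff, or_true,
    and_self, Vars.set]
  refine (run_loop I.n (170 * (I.n + 1) ^ 3 + 2) (fun m s => ∃ r' S', s = I.st r' S' c ∧
    r'.v = m ∧ (r'.found = 0 ∧ r.found = 0 ∧ (∀ v < m, ¬ I.Accepts (I.search c v)) ∨
        r'.found = 1 ∧ I.Witness S')) ?_ ?_ ?_).mono ?_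
  · refine ⟨_, _, rfl, rfl, ?_⟩
    rcases h with h | h
    · exact .inl ⟨h, h, by simp⟩
    · exact .inr h
  · rintro m s hm ⟨r', S', rfl, h1, h2⟩
    refine ⟨by simpa [st_reg, regs, h1] using hm, ?_⟩
    rw [run_seq, run_ite]
    simp only [st_reg, regs]
    rcases h2 with ⟨h2, h3, h4⟩ | ⟨h2, h3⟩
    · rw [if_pos (by omega)]
      refine run_seq.2 ((run_searchProg r' (by omega)).mono ?_)
      rintro k s ⟨hk, r'', rfl, g1, g2, g3⟩
      refine (run_checkProg r'').mono ?_
      rintro l s ⟨hl, r₃, rfl, f1, f2⟩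
      simp only [run_instr, apply_add, Nat.reduceLeDiff, or_true, and_self, Vars.set, regs]
      have hl' : 50 * (I.n + 1) ^ 2 ≤ 50 * (I.n + 1) ^ 3 :=
        Nat.mul_le_mul_left _ (Nat.pow_le_pow_right (by omega) (by omega))
      refine ⟨by omega, _, _, rfl, by simp [f2, g3, h1], ?_⟩
      rw [g1, Prod.mk.eta, h1] at f1
      split_ifs at f1 with hA
      · exact .inr ⟨f1, c, m, hm, by rw [h1], hA⟩
      · refine .inl ⟨by simp [f1, g2, h2], h3, fun v hv => ?_⟩
        rcases Nat.lt_succ_iff_lt_or_eq.1 hv with hv | rfl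
        · exact h4 v hv
        · exact hA
    · rw [if_neg (by omega)]
      simp only [run_skip, run_instr, apply_add, Nat.reduceLeDiff, or_true, and_self, Vars.set,
        regs]
      exact ⟨by omega, _, _, rfl, by simp [h1], .inr ⟨h2, h3⟩⟩
  · rintro s ⟨r', S', rfl, h1, -⟩
    simp [st_reg, regs, h1]
  · rintro k s ⟨hk, r', S', rfl, h1, h2⟩
    refine ⟨?_, r', S', rfl, h2⟩
    have : 1 ≤ (I.n + 1) ^ 3 := Nat.one_le_pow _ _ (by omega)
    have e : (I.n + 1) ^ 4 = I.n * (I.n + 1) ^ 3 + (I.n + 1) ^ 3 := by ring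
    nlinarith

/-! ### Enumeration of the choice vectors -/

/-- The next choice vector. -/
def nextProg : Program :=
  add 14 11 6 ;; load 17 14 ;; add 17 17 7 ;;
  .loop 5 17 (store 14 6 ;; add 14 14 7 ;; load 17 14 ;; add 17 17 7) ;;
  store 14 17 ;; add 17 11 3 ;; load 27 17

/-- The choice vector number `k`: its entries are the digits of `k` in base `d + 1`. -/
def digit (I : CSRSInstance) (k j : ℕ) : ℕ := k / (I.d + 1) ^ j % (I.d + 1)

/-- This is the carry: the hypothesis says that all digits below `j` are `d`, so they become `0`,
digit `j` grows by one without overflow, and the higher digits stay. -/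
theorem digit_succ_of_dvd {k j q : ℕ} (h : k + 1 = (I.d + 1) ^ j * q) (hj : I.digit k j < I.d) :
    I.digit (k + 1) = Function.update (fun i => if i < j then 0 else I.digit k i) j
      (I.digit k j + 1) := by
  obtain ⟨q, rfl⟩ : ∃ q', q = q' + 1 := Nat.exists_eq_succ_of_ne_zero (by rintro rfl; simp at h)
  have hb : 0 < (I.d + 1) ^ j := by positivity
  have hk : k / (I.d + 1) ^ j = q := by
    rw [Nat.div_eq_iff hb]
    constructor
    · nlinarith
    · have : (I.d + 1) ^ j * (q + 1) = q * (I.d + 1) ^ j + (I.d + 1) ^ j := by ring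
      omega
  have hk' : (k + 1) / (I.d + 1) ^ j = q + 1 := by rw [h, Nat.mul_div_cancel_left _ hb]
  rw [digit, hk] at hj
  have hq : q + 1 = (q % (I.d + 1) + 1) + (I.d + 1) * (q / (I.d + 1)) := by
    have := Nat.mod_add_div q (I.d + 1)
    omega
  have hmod : (q + 1) % (I.d + 1) = q % (I.d + 1) + 1 := by
    rw [hq, Nat.add_mul_mod_self_left, Nat.mod_eq_of_lt (by omega)]
  have hdiv : (q + 1) / (I.d + 1) = q / (I.d + 1) := by
    rw [hq, Nat.add_mul_div_left _ _ (by omega), Nat.div_eq_of_lt (by omega), Nat.zero_add]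
  funext i
  rcases lt_trichotomy i j with hi | rfl | hi
  · rw [Function.update_of_ne hi.ne, if_pos hi, digit, h]
    obtain ⟨m, rfl⟩ := Nat.exists_eq_add_of_lt hi
    rw [show (I.d + 1) ^ (i + m + 1) * (q + 1) =
      (I.d + 1) ^ i * ((I.d + 1) * ((I.d + 1) ^ m * (q + 1))) by ring,
      Nat.mul_div_cancel_left _ (by positivity), Nat.mul_mod_right]
  · rw [Function.update_self, digit, digit, hk, hk', hmod]
  · rw [Function.update_of_ne hi.ne', if_neg (by omega), digit, digit]
    obtain ⟨m, rfl⟩ := Nat.exists_eq_add_of_lt hi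
    rw [show (I.d + 1) ^ (j + m + 1) = (I.d + 1) ^ j * ((I.d + 1) * (I.d + 1) ^ m) by ring,
      ← Nat.div_div_eq_div_mul, ← Nat.div_div_eq_div_mul, ← Nat.div_div_eq_div_mul,
      ← Nat.div_div_eq_div_mul, hk, hk', hdiv]

/-- Digits never exceed `d`, so the hypothesis makes the last `j` digits equal to `d`, that is, `k`
is congruent to `-1` modulo `(d + 1) ^ j`. -/
theorem pow_dvd_succ_of_digit {k j : ℕ} (h : ∀ i < j, ¬ I.digit k i < I.d) :
    (I.d + 1) ^ j ∣ k + 1 := by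
  induction j with
  | zero => simp
  | succ j ih =>
    obtain ⟨q, hq⟩ := ih fun i hi => h i (by omega)
    obtain ⟨q, rfl⟩ : ∃ q', q = q' + 1 := Nat.exists_eq_succ_of_ne_zero (by rintro rfl; simp at hq)
    have hb : 0 < (I.d + 1) ^ j := by positivity
    have hk : k / (I.d + 1) ^ j = q := by
      rw [Nat.div_eq_iff hb]
      constructor
      · nlinarith
      · have : (I.d + 1) ^ j * (q + 1) = q * (I.d + 1) ^ j + (I.d + 1) ^ j := by ring
        omega
    have hj := h j (by omega)
    rw [digit, hk] at hj
    have hlt := Nat.mod_lt q (show 0 < I.d + 1 by omega)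
    have hdiv := Nat.mod_add_div q (I.d + 1)
    rw [hq, pow_succ]
    exact Nat.mul_dvd_mul_left _ ⟨q / (I.d + 1) + 1, by rw [Nat.mul_add]; omega⟩

theorem run_nextProg (r : Vars) {k : ℕ} (hk : k < (I.d + 1) ^ I.t) :
    Run nextProg (I.st r S (I.digit k)) fun l s => l ≤ 5 * I.t + 10 ∧
      ∃ r', s = I.st r' S (I.digit (k + 1)) ∧ r'.found = r.found ∧
        r'.f = I.digit (k + 1) I.t := by
  -- Digit `t` of `k` is `0`, which is less than `d`; hence the carry stops at position `t` at the
  -- latest.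
  have hex : ∃ j, I.digit k j < I.d := ⟨I.t, by
    rw [digit, Nat.div_eq_of_lt hk, Nat.zero_mod]; exact I.d_pos⟩
  set N := Nat.find hex with hN
  have hNt : N ≤ I.t := Nat.find_le (by
    rw [digit, Nat.div_eq_of_lt hk, Nat.zero_mod]; exact I.d_pos)
  have hNd : I.digit k N < I.d := Nat.find_spec hex
  have hmin : ∀ i < N, ¬ I.digit k i < I.d := fun i hi => Nat.find_min hex hi
  have hc0 := memory_choice (I := I) (S := S) (c := I.digit k) 0
  simp only [nextProg, run_seq, run_instr, apply_add, apply_load, Nat.reduceLeDiff, or_true,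
    and_self, Vars.set, regs]
  -- `tmp` holds the digit plus one: comparing `d` with it detects a digit `d`, and when the loop
  -- stops it is the new value to be stored.
  refine (run_loop N 4 (fun m s => s = I.st { r with
    x := I.base + I.n + m, tmp := I.digit k m + 1 } S
      fun i => if i < m then 0 else I.digit k i) ?_ ?_ ?_).mono ?_
  · simp [← hc0]
  · rintro m s hm rfl
    have := hmin m hm
    refine ⟨by simp only [st_reg, regs]; omega, ?_⟩
    rw [run_seq, run_instr, apply_store_choice _ _ _ m (by simp [regs])]
    simp only [run_seq, run_instr, apply_add, apply_load, Nat.reduceLeDiff, or_true,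
      and_self, Vars.set, regs, Nat.add_assoc (I.base + I.n), memory_choice]
    refine ⟨by omega, ?_⟩
    rw [Function.update_of_ne (by omega), if_neg (by omega)]
    congr 1
    funext i
    simp only [Function.update_apply]
    split_ifs <;> first | rfl | omega
  · rintro s rfl
    simp only [st_reg, regs]
    omega
  · rintro l s ⟨hl, rfl⟩
    obtain ⟨q, hq⟩ := pow_dvd_succ_of_digit hmin
    rw [apply_store_choice _ _ _ N (by simp [regs])]
    simp only [apply_add, apply_load, Nat.reduceLeDiff, or_true,
      and_self, Vars.set, regs, memory_choice, ← digit_succ_of_dvd hq hNd]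
    exact ⟨by omega, _, rfl, rfl, rfl⟩

/-- Horner's scheme: split off `e 0` and apply induction to the shifted vector. -/
theorem exists_digit_eq {t : ℕ} {e : ℕ → ℕ} (h1 : ∀ j, e j ≤ I.d) (h2 : ∀ j, t ≤ j → e j = 0) :
    ∃ k < (I.d + 1) ^ t, I.digit k = e := by
  induction t generalizing e with
  | zero =>
    refine ⟨0, by simp, ?_⟩
    funext j
    simp [digit, h2 j]
  | succ t ih =>
    obtain ⟨k, hk, he⟩ := ih (e := fun j => e (j + 1)) (fun j => h1 _) fun j hj => h2 _ (by omega)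
    have h0 := h1 0
    refine ⟨e 0 + (I.d + 1) * k, ?_, ?_⟩
    · rw [pow_succ']
      nlinarith
    · funext j
      cases j with
      | zero => simp [digit, Nat.mod_eq_of_lt (Nat.lt_succ_of_le h0)]
      | succ j =>
        rw [digit, pow_succ', ← Nat.div_div_eq_div_mul, Nat.add_mul_div_left _ _ (by omega),
          Nat.div_eq_of_lt (show e 0 < I.d + 1 by omega), Nat.zero_add]
        exact congrFun he j

/-- The search for all choice vectors. -/
def loopProg : Program := .loop 27 7 (sweepProg ;; nextProg)

theorem run_loopProg (r : Vars) (h : r.found = 0) (hf : r.f = 0) :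
    Run loopProg (I.st r S 0) fun k s =>
      k ≤ 200 * ((I.d + 1) ^ I.t * (I.t + 1)) * (I.n + 1) ^ 4 + 1 ∧ ∃ r' S' c, s = I.st r' S' c ∧
      (r'.found = 0 ∧ (∀ k < (I.d + 1) ^ I.t, ∀ v < I.n, ¬ I.Accepts (I.search (I.digit k) v)) ∨
        r'.found = 1 ∧ I.Witness S') := by
  refine (run_loop ((I.d + 1) ^ I.t) (180 * (I.n + 1) ^ 4 + (5 * I.t + 10))
    (fun m s => ∃ r' S', s = I.st r' S' (I.digit m) ∧ r'.f = I.digit m I.t ∧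
      (r'.found = 0 ∧ (∀ k < m, ∀ v < I.n, ¬ I.Accepts (I.search (I.digit k) v)) ∨
        r'.found = 1 ∧ I.Witness S')) ?_ ?_ ?_).mono ?_
  · exact ⟨r, S, by congr 1; funext j; simp [digit], by simp [hf, digit], .inl ⟨h, by simp⟩⟩
  · rintro m s hm ⟨r', S', rfl, h1, h2⟩
    refine ⟨by simp [st_reg, regs, h1, digit, Nat.div_eq_of_lt hm], ?_⟩
    refine run_seq.2 ((run_sweepProg r' (h2.imp And.left id)).mono ?_)
    rintro k s ⟨hk, r'', S'', rfl, g⟩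
    refine (run_nextProg r'' hm).mono ?_
    rintro l s ⟨hl, r₃, rfl, f1, f2⟩
    refine ⟨by omega, r₃, S'', rfl, f2, ?_⟩
    rcases g with ⟨g1, g2, g3⟩ | ⟨g1, g2⟩
    · refine .inl ⟨by omega, fun k hk v hv => ?_⟩
      rcases Nat.lt_succ_iff_lt_or_eq.1 hk with hk | rfl
      · exact (h2.resolve_right (by omega)).2 k hk v hv
      · exact g3 v hv
    · exact .inr ⟨by omega, g2⟩
  -- Digit `t`, held in `f`, is `0` for all numbers below `(d + 1) ^ t` and is `1` at that number,
  -- where the loop stops.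
  · rintro s ⟨r', S', rfl, h1, -⟩
    have := I.d_pos
    simp [st_reg, regs, h1, digit, Nat.mod_eq_of_lt (show 1 < I.d + 1 by omega)]
  · rintro k s ⟨hk, r', S', rfl, -, h2⟩
    refine ⟨hk.trans ?_, r', S', _, rfl, h2⟩
    have h1 : 180 * (I.n + 1) ^ 4 + (5 * I.t + 10) + 1 ≤ 200 * ((I.t + 1) * (I.n + 1) ^ 4) := by
      have : 1 ≤ (I.n + 1) ^ 4 := Nat.one_le_pow _ _ (by omega)
      nlinarith
    calc _ ≤ (I.d + 1) ^ I.t * (200 * ((I.t + 1) * (I.n + 1) ^ 4)) + 1 :=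
          Nat.add_le_add_right (Nat.mul_le_mul_left _ h1) _
      _ = _ := by ring

/-! ### Initialization -/

/-- The constants are loaded and the addresses of the arrays are computed. -/
def initProg : Program :=
  const 7 1 ;; const 8 2 ;; const 9 4 ;; load 2 6 ;; load 3 7 ;; load 4 8 ;; const 17 3 ;;
  load 5 17 ;; add 10 9 2 ;; add 1 10 6 ;;
  .loop 14 2 (add 1 1 2 ;; add 14 14 7) ;; add 11 1 2

theorem regs_of_ge (r : Vars) {j : ℕ} (hj : 28 ≤ j) : I.regs r j = 0 := by
  unfold regs
  split <;> first | rfl | omega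

theorem run_initProg :
    Run initProg I.initialState fun k s => k ≤ 3 * I.n + 12 ∧
      ∃ r, s = I.st r 0 0 ∧ r.found = 0 ∧ r.f = 0 := by
  have hs : I.initialState = ⟨fun _ => 0, I.memory 0 0⟩ := by
    rw [← initialState_mem]
    rfl
  rw [hs]
  simp only [initProg, run_seq, run_instr, Instr.apply]
  simp [memory_zero, memory_one, memory_two, memory_three]
  -- Register `1` reaches the input length by adding `n` to `4 + n` a total of `n` times. Register
  -- `11` is not set yet and is masked; the `3` is left over from reading `d`.
  refine (run_loop I.n 2 (fun m s => s = ⟨fun j => if j = 1 then 4 + I.n + m * I.n else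
    if j = 11 then 0 else I.regs ⟨0, 0, 0, m, 0, 0, 3, 0, 0, 0, 0, 0, 0, 0, 0, 0, 0⟩ j,
    I.memory 0 0⟩) ?_ ?_ ?_).mono ?_
  · simp only [State.mk.injEq, and_true]
    funext j
    rcases lt_or_ge j 28 with hj | hj
    · interval_cases j <;> simp [regs, Function.update]
    · simp only [Function.update_apply, regs_of_ge _ hj]
      split_ifs <;> first | rfl | omega
  · rintro m s hm rfl
    refine ⟨by simpa [regs] using hm, ?_⟩
    simp only [run_seq, run_instr, Instr.apply]
    have h2 (r : Vars) : I.regs r 2 = I.n := rfl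
    have h7 (r : Vars) : I.regs r 7 = 1 := rfl
    have h14 (r : Vars) : I.regs r 14 = r.x := rfl
    simp [h2, h7, h14]
    funext j
    rcases lt_or_ge j 28 with hj | hj
    · interval_cases j <;> simp [regs, Function.update]
      ring
    · simp only [Function.update_apply, regs_of_ge _ hj]
      split_ifs
      all_goals first | rfl | omega
  · rintro s rfl
    simp [regs]
  · rintro k s ⟨hk, rfl⟩
    refine ⟨by omega, ⟨0, 0, 0, I.n, 0, 0, 3, 0, 0, 0, 0, 0, 0, 0, 0, 0, 0⟩, ?_, rfl, rfl⟩
    simp only [st, State.mk.injEq, and_true]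
    funext j
    rcases lt_or_ge j 28 with hj | hj
    · interval_cases j <;> simp [regs, Function.update, base]
    · simp only [Function.update_apply, regs_of_ge _ hj]
      split_ifs <;> first | rfl | omega

open Classical

/-! ### Labels as finite sets of vertices -/

section Assign

variable {x k u y : ℕ}

/-- An undecided neighbor is determined by its rank, since `Nat.count` is injective on the positions
it counts. -/
theorem assign_eq_update (hy : y < I.n) (hxy : I.Adj x y) (h0 : S y = 0)
    (hk : I.undecidedCount S x y = k) : I.assign S x k u I.n = Function.update S y u := by
  funext z
  by_cases hz : z = y
  · subst hz
    simp [assign, hy, hxy, h0, hk]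
  · rw [Function.update_of_ne hz, assign, if_neg]
    rintro ⟨-, h1, h2⟩
    exact hz (Nat.count_injective (p := fun y => I.Adj x y ∧ S y = 0) h1 ⟨hxy, h0⟩ (h2.trans hk.symm))

/-- A guess beyond the last undecided neighbor changes no label. -/
theorem assign_eq_self (hk : I.undecidedCount S x I.n ≤ k) : I.assign S x k u I.n = S := by
  funext z
  rw [assign, if_neg]
  rintro ⟨h1, h2, h3⟩
  have := Nat.count_strict_mono (p := fun y => I.Adj x y ∧ S y = 0) h2 h1
  simp only [undecidedCount] at hk h3
  omega

theorem exists_undecidedCount_eq {m : ℕ} (hk : k < I.undecidedCount S x m) :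
    ∃ y < m, I.Adj x y ∧ S y = 0 ∧ I.undecidedCount S x y = k := by
  induction m with
  | zero => simp [undecidedCount] at hk
  | succ m ih =>
    by_cases h : k < I.undecidedCount S x m
    · obtain ⟨y, hy, h'⟩ := ih h
      exact ⟨y, by omega, h'⟩
    · rw [undecidedCount, Nat.count_succ, ← undecidedCount] at hk
      split_ifs at hk with h1
      · exact ⟨m, by omega, h1.1, h1.2, by omega⟩
      · omega

end Assign

variable (I) in
/-- The set of the vertices with label `u`. -/
noncomputable def labelSet (S : ℕ → ℕ) (u : ℕ) : Finset (Fin I.n) :=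
  Finset.univ.filter fun v => S v = u

theorem mem_labelSet {u : ℕ} {v : Fin I.n} : v ∈ I.labelSet S u ↔ S v = u := by
  simp [labelSet]

theorem labelSet_update_same {y : Fin I.n} {u : ℕ} :
    I.labelSet (Function.update S y u) u = insert y (I.labelSet S u) := by
  ext z
  by_cases h : z = y
  · simp [mem_labelSet, h]
  · have : (z : ℕ) ≠ y := fun h' => h (Fin.ext h')
    simp [mem_labelSet, h, this]

theorem labelSet_update_of_ne {y : Fin I.n} {u w : ℕ} (h1 : w ≠ u) (h2 : w ≠ S y) :
    I.labelSet (Function.update S y u) w = I.labelSet S w := by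
  ext z
  by_cases h : z = y
  · simp [mem_labelSet, h, h1.symm, h2.symm]
  · have : (z : ℕ) ≠ y := fun h' => h (Fin.ext h')
    simp [mem_labelSet, this]

theorem labelSet_update_zero {y : Fin I.n} {u : ℕ} (hu : u ≠ 0) :
    I.labelSet (Function.update S y u) 0 = (I.labelSet S 0).erase y := by
  ext z
  by_cases h : z = y
  · simp [mem_labelSet, h, hu]
  · have : (z : ℕ) ≠ y := fun h' => h (Fin.ext h')
    simp [mem_labelSet, h, this]

theorem count_adj_eq_card (x : Fin I.n) (u : ℕ) :
    Nat.count (fun y => I.Adj x y ∧ S y = u) I.n =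
      (I.G.neighborFinset x ∩ I.labelSet S u).card := by
  rw [Nat.count_eq_card_filter_range, Finset.card_filter, Finset.sum_range, ← Finset.card_filter]
  congr 1
  ext y
  simp [mem_labelSet, Adj]

theorem chosenCount_eq (x : Fin I.n) :
    I.chosenCount S x I.n = (I.G.neighborFinset x ∩ I.labelSet S 1).card := by
  rw [← count_adj_eq_card, chosenCount]

theorem undecidedCount_eq (x : Fin I.n) :
    I.undecidedCount S x I.n = (I.G.neighborFinset x ∩ I.labelSet S 0).card := by
  rw [← count_adj_eq_card, undecidedCount]

theorem chosenWeight_eq : I.chosenWeight S I.n = ∑ v ∈ I.labelSet S 1, I.ω v := by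
  rw [chosenWeight, Finset.sum_range, labelSet, Finset.sum_filter]
  simp [wt]

/-- The two truncated differences in the summand vanish together exactly when the count equals `d`.
-/
theorem defect_eq_zero : I.defect S I.n = 0 ↔ ∀ x ∈ I.labelSet S 1,
    (I.G.neighborFinset x ∩ I.labelSet S 0).card = 0 ∧
      (I.G.neighborFinset x ∩ I.labelSet S 1).card = I.d := by
  rw [defect, Finset.sum_range, Finset.sum_eq_zero_iff]
  simp only [Finset.mem_univ, true_imp_iff, mem_labelSet, ← chosenCount_eq, ← undecidedCount_eq]
  refine forall_congr' fun x => ?_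
  split_ifs with h
  · simp only [h, true_imp_iff]
    omega
  · simp [h]

theorem degree_induce (U : Finset (Fin I.n)) (x : (U : Set (Fin I.n))) :
    (I.G.induce (U : Set (Fin I.n))).degree x = (I.G.neighborFinset x ∩ U).card := by
  rw [← SimpleGraph.card_neighborFinset_eq_degree,
    ← Finset.card_map (.subtype (· ∈ (U : Set (Fin I.n))))]
  congr 1
  ext y
  simp

theorem mem_openNbhd {U : Finset (Fin I.n)} {y : Fin I.n} :
    y ∈ I.G.openNbhd (U : Set (Fin I.n)) ↔ (∃ x ∈ U, I.G.Adj x y) ∧ y ∉ U := by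
  simp [SimpleGraph.openNbhd]

/-- The undecided neighbor that `assign` changes is a vertex of the graph. -/
theorem exists_assign_eq {x : Fin I.n} {k : ℕ} (u : ℕ) (hk : k < I.undecidedCount S x I.n) :
    ∃ y : Fin I.n, I.G.Adj x y ∧ S y = 0 ∧ I.assign S x k u I.n = Function.update S y u := by
  obtain ⟨y, hy, h1, h2, h3⟩ := exists_undecidedCount_eq hk
  obtain ⟨_, _, h⟩ := id h1
  exact ⟨⟨y, hy⟩, h, h2, assign_eq_update hy h1 h2 h3⟩

/-! ### Soundness: accepted searches yield solutions -/

/-- The invariant of a search. -/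
def Sound (I : CSRSInstance) (σ : (ℕ → ℕ) × ℕ) : Prop :=
  (I.G.induce (I.labelSet σ.1 1 : Set (Fin I.n))).Connected ∧ (I.labelSet σ.1 2).card ≤ σ.2 ∧
    ∀ v : Fin I.n, σ.1 v ≤ 2

/-- A newly chosen vertex is adjacent to the chosen vertex `x`, which keeps the chosen set
connected. An out-of-range guess is counted but removes nothing, hence only an inequality for the
removed vertices. -/
theorem Sound.treat {σ : (ℕ → ℕ) × ℕ} (h : I.Sound σ) (x : Fin I.n) :
    I.Sound (I.treat c x σ) := by
  obtain ⟨S, i⟩ := σ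
  obtain ⟨h1, h2, h3⟩ := h
  simp only [CSRSInstance.treat]
  have bound (y : Fin I.n) (u : ℕ) (hu : u ≤ 2) (v : Fin I.n) : Function.update S y u v ≤ 2 := by
    rw [Function.update_apply]
    split_ifs
    · exact hu
    · exact h3 v
  split_ifs with hx hd
  · rcases lt_or_ge (c i) (I.undecidedCount S x I.n) with hk | hk
    · obtain ⟨y, -, hy, he⟩ := exists_assign_eq 2 hk
      rw [he]
      refine ⟨?_, ?_, bound y 2 le_rfl⟩
      · rwa [labelSet_update_of_ne (by omega) (by omega)]
      · rw [labelSet_update_same]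
        exact (Finset.card_insert_le _ _).trans (Nat.succ_le_succ h2)
    · rw [assign_eq_self hk]
      exact ⟨h1, h2.trans (Nat.le_succ _), h3⟩
  · rcases lt_or_ge 0 (I.undecidedCount S x I.n) with hk | hk
    · obtain ⟨y, hxy, hy, he⟩ := exists_assign_eq 1 hk
      rw [he]
      refine ⟨?_, ?_, bound y 1 (by omega)⟩
      · dsimp only
        rw [labelSet_update_same, Finset.coe_insert, Set.insert_eq, Set.union_comm]
        exact SimpleGraph.connected_induce_union h1.preconnected
          (SimpleGraph.Preconnected.of_subsingleton) (mem_labelSet.2 hx) rfl hxy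
      · dsimp only
        rwa [labelSet_update_of_ne (by omega) (by omega)]
    · rw [assign_eq_self hk]
      exact ⟨h1, h2, h3⟩
  · exact ⟨h1, h2, h3⟩

theorem Sound.treatList {xs : List ℕ} (hxs : ∀ x ∈ xs, x < I.n) {σ : (ℕ → ℕ) × ℕ}
    (h : I.Sound σ) : I.Sound (I.treatList c xs σ) := by
  induction xs generalizing σ with
  | nil => exact h
  | cons x xs ih =>
    exact ih (fun y hy => hxs y (List.mem_cons_of_mem _ hy))
      (h.treat ⟨x, hxs x List.mem_cons_self⟩)

theorem labelSet_start (v : Fin I.n) : I.labelSet (start v) 1 = {v} := by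
  ext z
  simp [mem_labelSet, start, Function.update_apply, Fin.ext_iff]

theorem mem_passes {m x : ℕ} (hx : x ∈ (List.replicate m (List.range I.n)).flatten) : x < I.n := by
  simp at hx
  exact hx.2

theorem sound_search (v : Fin I.n) : I.Sound (I.search c v) := by
  refine Sound.treatList (fun x => mem_passes) ⟨?_, ?_, fun z => ?_⟩
  · dsimp only
    rw [labelSet_start, Finset.coe_singleton]
    exact SimpleGraph.Connected.of_subsingleton
  · simp [labelSet, start, Function.update_apply, Finset.filter_eq_empty_iff]
    intro z
    split_ifs <;> simp
  · simp only [start, Function.update_apply]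
    split_ifs <;> simp

/-- With no undecided neighbors left, the neighborhood of the chosen set consists of removed
vertices, of which there are at most `t`. -/
theorem isSolution_of_accepts {σ : (ℕ → ℕ) × ℕ} (h : I.Sound σ) (ha : I.Accepts σ) :
    I.IsSolution (I.labelSet σ.1 1) := by
  obtain ⟨S, i⟩ := σ
  obtain ⟨h1, h2, h3⟩ := h
  obtain ⟨a1, a2, a3⟩ := ha
  rw [defect_eq_zero] at a1
  refine ⟨h1, ?_, ?_, chosenWeight_eq ▸ a3⟩
  · refine le_trans ?_ (h2.trans a2)
    rw [← Set.ncard_coe_finset]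
    refine Set.ncard_le_ncard (fun y hy => ?_)
    rw [mem_openNbhd] at hy
    obtain ⟨⟨x, hx, hxy⟩, hy⟩ := hy
    have h0 : S y ≠ 0 := fun h0 => by
      have := (a1 x hx).1
      rw [Finset.card_eq_zero] at this
      exact Finset.notMem_empty y (this ▸ by simp [mem_labelSet, hxy, h0])
    rw [mem_labelSet] at hy
    have : S y ≤ 2 := h3 y
    simp only [Finset.mem_coe, mem_labelSet]
    dsimp only at hy
    omega
  · intro x
    convert (a1 x x.2).2
    exact degree_induce _ x

theorem Witness.isSolution (h : I.Witness S) : I.IsSolution (I.labelSet S 1) := by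
  obtain ⟨c, v, hv, rfl, ha⟩ := h
  exact isSolution_of_accepts (sound_search ⟨v, hv⟩) ha

/-! ### Completeness: some choice vector leads to a solution -/

/-- The treatment of `x` changes nothing, provided that the labels are consistent with a solution. -/
def Stable (I : CSRSInstance) (S : ℕ → ℕ) (x : ℕ) : Prop :=
  S x = 1 → I.undecidedCount S x I.n = 0

/-- The labels are consistent with the solution `U`, and the second component of `σ` is the number
of the removed vertices. -/
def Guided (I : CSRSInstance) (U : Finset (Fin I.n)) (v : Fin I.n) (σ : (ℕ → ℕ) × ℕ) : Prop :=
  σ.1 v = 1 ∧ I.labelSet σ.1 1 ⊆ U ∧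
    (∀ y ∈ I.labelSet σ.1 2, y ∈ I.G.openNbhd (U : Set (Fin I.n))) ∧
    (I.labelSet σ.1 2).card = σ.2 ∧ ∀ y : Fin I.n, σ.1 y ≤ 2

/-- The treatment of `x` leads from `σ` to `σ'`: nothing changes, or a vertex is decided. -/
def Progress (I : CSRSInstance) (σ : (ℕ → ℕ) × ℕ) (x : ℕ) (σ' : (ℕ → ℕ) × ℕ) : Prop :=
  I.Stable σ.1 x ∧ σ' = σ ∨
    ¬ I.Stable σ.1 x ∧ (I.labelSet σ'.1 0).card < (I.labelSet σ.1 0).card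

theorem IsSolution.card_neighbors {U : Finset (Fin I.n)} (hU : I.IsSolution U) {x : Fin I.n}
    (hx : x ∈ U) : (I.G.neighborFinset x ∩ U).card = I.d := by
  rw [← degree_induce U ⟨x, hx⟩]
  convert hU.2.2.1 ⟨x, hx⟩

theorem card_erase_labelSet_lt {y : Fin I.n} {u : ℕ} (hu : u ≠ 0) (hy : S y = 0) :
    (I.labelSet (Function.update S y u) 0).card < (I.labelSet S 0).card := by
  rw [labelSet_update_zero hu]
  exact Finset.card_erase_lt_of_mem (mem_labelSet.2 hy)

theorem update_le_two (h : ∀ y : Fin I.n, S y ≤ 2) (y : Fin I.n) {u : ℕ} (hu : u ≤ 2)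
    (v : Fin I.n) : Function.update S y u v ≤ 2 := by
  rw [Function.update_apply]
  split_ifs
  · exact hu
  · exact h v

/-- If all undecided neighbors of `x` were in `U`, then `x` would have more than `d` neighbors
there. The undecided neighbors before the first one outside `U` are neighbors of `x` in `U`, so its
rank is at most `d`. -/
theorem Guided.treat_of_lt {U : Finset (Fin I.n)} (hU : I.IsSolution U) {v x : Fin I.n}
    {σ : (ℕ → ℕ) × ℕ} (h : I.Guided U v σ) (hx : σ.1 x = 1)
    (hd : I.d < I.chosenCount σ.1 x I.n + I.undecidedCount σ.1 x I.n) :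
    ∃ k ≤ I.d, ∀ c : ℕ → ℕ, c σ.2 = k →
      I.Guided U v (I.treat c x σ) ∧ I.Progress σ x (I.treat c x σ) := by
  obtain ⟨S, i⟩ := σ
  obtain ⟨h1, h2, h3, h4, h5⟩ := h
  dsimp only at *
  have hxU : x ∈ U := h2 (mem_labelSet.2 hx)
  have hcard := hU.card_neighbors hxU
  have hex : ∃ y : ℕ, ∃ hy : y < I.n, I.G.Adj x ⟨y, hy⟩ ∧ S y = 0 ∧ ⟨y, hy⟩ ∉ U := by
    by_contra! hcon
    have hsub : (I.G.neighborFinset x ∩ I.labelSet S 1) ∪ (I.G.neighborFinset x ∩ I.labelSet S 0) ⊆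
        I.G.neighborFinset x ∩ U := by
      intro y hy
      simp only [Finset.mem_union, Finset.mem_inter, SimpleGraph.mem_neighborFinset] at hy ⊢
      rcases hy with ⟨h6, h7⟩ | ⟨h6, h7⟩
      · exact ⟨h6, h2 h7⟩
      · exact ⟨h6, hcon y y.2 h6 (mem_labelSet.1 h7)⟩
    have hdis : Disjoint (I.G.neighborFinset x ∩ I.labelSet S 1)
        (I.G.neighborFinset x ∩ I.labelSet S 0) := by
      rw [Finset.disjoint_left]
      intro y hy hy'
      simp only [Finset.mem_inter, mem_labelSet] at hy hy'
      omega
    have := Finset.card_le_card hsub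
    rw [Finset.card_union_of_disjoint hdis, ← chosenCount_eq, ← undecidedCount_eq, hcard] at this
    omega
  obtain ⟨hy, hxy, hy0, hyU⟩ := Nat.find_spec hex
  set y := Nat.find hex
  have hmin : ∀ z : Fin I.n, (z : ℕ) < y → I.G.Adj x z → S z = 0 → z ∈ U := by
    intro z hz h6 h7
    by_contra h8
    exact Nat.find_min hex hz ⟨z.2, h6, h7, h8⟩
  refine ⟨I.undecidedCount S x y, ?_, fun c hc => ?_⟩
  · rw [← hcard, undecidedCount, Nat.count_eq_card_filter_range,
      ← Finset.card_map Fin.valEmbedding]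
    refine Finset.card_le_card fun z hz => ?_
    simp only [Finset.mem_filter, Finset.mem_range] at hz
    obtain ⟨hzy, ⟨_, hzn, hxz⟩, hz0⟩ := hz
    exact Finset.mem_map.2 ⟨⟨z, hzn⟩, by
      simpa using ⟨hxz, hmin ⟨z, hzn⟩ hzy hxz hz0⟩, rfl⟩
  · have he : I.treat c x (S, i) = (Function.update S y 2, i + 1) := by
      simp only [treat, hx, hd, ↓reduceIte]
      rw [assign_eq_update hy ⟨x.2, hy, hxy⟩ hy0 hc.symm]
    rw [he]
    have hyx : y ≠ v := by
      intro h
      rw [h] at hy0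
      omega
    refine ⟨⟨?_, ?_, ?_, ?_, ?_⟩, .inr ⟨?_, ?_⟩⟩
    · dsimp only
      rwa [Function.update_of_ne hyx.symm]
    · dsimp only
      rwa [labelSet_update_of_ne (y := ⟨y, hy⟩) (by omega) (by dsimp only; omega)]
    · intro z hz
      rw [labelSet_update_same (y := ⟨y, hy⟩), Finset.mem_insert] at hz
      rcases hz with rfl | hz
      · exact mem_openNbhd.2 ⟨⟨x, hxU, hxy⟩, hyU⟩
      · exact h3 z hz
    · dsimp only
      rw [labelSet_update_same (y := ⟨y, hy⟩), Finset.card_insert_of_notMem, h4]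
      simp [mem_labelSet, hy0]
    · exact update_le_two h5 ⟨y, hy⟩ le_rfl
    · intro hs
      have := hs hx
      rw [undecidedCount, Nat.count_iff_forall_not] at this
      exact this y hy ⟨⟨x.2, hy, hxy⟩, hy0⟩
    · exact card_erase_labelSet_lt (y := ⟨y, hy⟩) (by omega) hy0

/-- The `d` neighbors of `x` in `U` are among its at most `d` chosen and undecided neighbors, so the
two sets coincide. -/
theorem Guided.treat_of_le {U : Finset (Fin I.n)} (hU : I.IsSolution U) {v x : Fin I.n}
    {σ : (ℕ → ℕ) × ℕ} (h : I.Guided U v σ) (hx : σ.1 x = 1)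
    (hd : ¬ I.d < I.chosenCount σ.1 x I.n + I.undecidedCount σ.1 x I.n) (c : ℕ → ℕ) :
    I.Guided U v (I.treat c x σ) ∧ I.Progress σ x (I.treat c x σ) := by
  obtain ⟨S, i⟩ := σ
  obtain ⟨h1, h2, h3, h4, h5⟩ := id h
  dsimp only at *
  have hxU : x ∈ U := h2 (mem_labelSet.2 hx)
  have hcard := hU.card_neighbors hxU
  have hdis : Disjoint (I.G.neighborFinset x ∩ I.labelSet S 1)
      (I.G.neighborFinset x ∩ I.labelSet S 0) := by
    rw [Finset.disjoint_left]
    intro y hy hy'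
    simp only [Finset.mem_inter, mem_labelSet] at hy hy'
    omega
  have hsub : I.G.neighborFinset x ∩ U ⊆
      (I.G.neighborFinset x ∩ I.labelSet S 1) ∪ (I.G.neighborFinset x ∩ I.labelSet S 0) := by
    intro y hy
    simp only [Finset.mem_union, Finset.mem_inter, SimpleGraph.mem_neighborFinset,
      mem_labelSet] at hy ⊢
    have h6 : S y ≠ 2 := fun h6 => (mem_openNbhd.1 (h3 y (mem_labelSet.2 h6))).2 hy.2
    have h7 := h5 y
    have h8 : S y = 1 ∨ S y = 0 := by omega
    exact h8.imp (⟨hy.1, ·⟩) (⟨hy.1, ·⟩)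
  have heq := Finset.eq_of_subset_of_card_le hsub (by
    rw [Finset.card_union_of_disjoint hdis, ← chosenCount_eq, ← undecidedCount_eq, hcard]
    omega)
  have he : I.treat c x (S, i) = (I.assign S x 0 1 I.n, i) := by
    simp only [treat, hx, hd, ↓reduceIte]
  rw [he]
  rcases lt_or_ge 0 (I.undecidedCount S x I.n) with hk | hk
  · obtain ⟨y, hxy, hy0, hy⟩ := exists_assign_eq 1 hk
    have hyU : y ∈ U := by
      have : y ∈ I.G.neighborFinset x ∩ U := by
        rw [heq]
        simp [mem_labelSet, hxy, hy0]
      exact (Finset.mem_inter.1 this).2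
    rw [hy]
    refine ⟨⟨?_, ?_, ?_, ?_, ?_⟩, .inr ⟨?_, ?_⟩⟩
    · dsimp only
      rw [Function.update_apply]
      split_ifs
      · rfl
      · exact h1
    · dsimp only
      rw [labelSet_update_same]
      exact Finset.insert_subset hyU h2
    · dsimp only
      rwa [labelSet_update_of_ne (by omega) (by omega)]
    · dsimp only
      rwa [labelSet_update_of_ne (by omega) (by omega)]
    · exact update_le_two h5 y (by omega)
    · exact fun hs => hk.ne' (hs hx)
    · exact card_erase_labelSet_lt (by omega) hy0
  · rw [assign_eq_self hk]
    exact ⟨h, .inl ⟨fun _ => by simpa using hk, rfl⟩⟩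

/-- Removed vertices are neighbors of the `t`-secluded set `U`. -/
theorem Guided.le {U : Finset (Fin I.n)} (hU : I.IsSolution U) {v : Fin I.n}
    {σ : (ℕ → ℕ) × ℕ} (h : I.Guided U v σ) : σ.2 ≤ I.t := by
  obtain ⟨-, -, h3, h4, -⟩ := h
  rw [← h4, ← Set.ncard_coe_finset]
  exact (Set.ncard_le_ncard h3).trans hU.2.1

/-- Every step of the treatment of a list keeps the consistency with `U`. -/
def GuidedRun (I : CSRSInstance) (U : Finset (Fin I.n)) (v : Fin I.n) (c : ℕ → ℕ) :
    List ℕ → (ℕ → ℕ) × ℕ → Prop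
  | [], _ => True
  | x :: xs, σ => I.Guided U v (I.treat c x σ) ∧ I.Progress σ x (I.treat c x σ) ∧
      GuidedRun I U v c xs (I.treat c x σ)

/-- The treatment reads only entry `σ.2` of the vector, and later ones read only later entries once
it is used. So the vector is built from the end of the list, by updating the one for the remaining
list. -/
theorem exists_guidedRun {U : Finset (Fin I.n)} (hU : I.IsSolution U) {v : Fin I.n}
    (xs : List ℕ) (hxs : ∀ x ∈ xs, x < I.n) (σ : (ℕ → ℕ) × ℕ) (h : I.Guided U v σ) :
    ∃ e : ℕ → ℕ, (∀ j, e j ≤ I.d) ∧ (∀ j, I.t ≤ j → e j = 0) ∧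
      ∀ c, (∀ j, σ.2 ≤ j → c j = e j) → I.GuidedRun U v c xs σ := by
  induction xs generalizing σ with
  | nil => exact ⟨0, by simp, by simp, fun c _ => trivial⟩
  | cons x xs ih =>
    have hx : x < I.n := hxs x List.mem_cons_self
    replace ih := ih fun y hy => hxs y (List.mem_cons_of_mem _ hy)
    by_cases h1 : σ.1 x = 1
    · by_cases h2 : I.d < I.chosenCount σ.1 x I.n + I.undecidedCount σ.1 x I.n
      · obtain ⟨k, hk, hc⟩ := h.treat_of_lt hU (x := ⟨x, hx⟩) h1 h2
        have he (c : ℕ → ℕ) : I.treat c x σ = (I.assign σ.1 x (c σ.2) 2 I.n, σ.2 + 1) := by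
          simp only [treat, h1, h2, ↓reduceIte]
        -- Only the entry at `σ.2` influences this step, so a constant vector can stand in for the
        -- one still to be constructed.
        have hg := (hc (fun _ => k) rfl).1
        obtain ⟨e, e1, e2, e3⟩ := ih _ hg
        -- The bound holds after the removal, hence strictly before it; so the updated entry lies
        -- below `t`.
        have hlt : σ.2 < I.t := by
          have := hg.le hU
          rw [he] at this
          exact this
        refine ⟨Function.update e σ.2 k, fun j => ?_, fun j hj => ?_, fun c hce => ?_⟩
        · rw [Function.update_apply]
          split_ifs
          · exact hk
          · exact e1 j
        · rw [Function.update_of_ne (by omega)]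
          exact e2 j hj
        · have hck : c σ.2 = k := by rw [hce _ le_rfl, Function.update_self]
          obtain ⟨g1, g2⟩ := hc c hck
          refine ⟨g1, g2, ?_⟩
          have hsame : I.treat c x σ = I.treat (fun _ => k) x σ := by rw [he, he, hck]
          rw [hsame]
          refine e3 c fun j hj => ?_
          rw [he] at hj
          dsimp only at hj
          rw [hce j (by omega), Function.update_of_ne (by omega)]
      · have he (c c' : ℕ → ℕ) : I.treat c x σ = I.treat c' x σ := by
          simp only [treat, h1, h2, ↓reduceIte]
        have he' : (I.treat 0 x σ).2 = σ.2 := by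
          simp only [treat, h1, h2, ↓reduceIte]
        obtain ⟨g1, g2⟩ := h.treat_of_le hU (x := ⟨x, hx⟩) h1 h2 0
        obtain ⟨e, e1, e2, e3⟩ := ih _ g1
        refine ⟨e, e1, e2, fun c hce => ?_⟩
        rw [GuidedRun, he c 0]
        exact ⟨g1, g2, e3 c (by rwa [he'])⟩
    · have he (c : ℕ → ℕ) : I.treat c x σ = σ := by simp only [treat, h1, ↓reduceIte]
      obtain ⟨e, e1, e2, e3⟩ := ih σ h
      refine ⟨e, e1, e2, fun c hce => ?_⟩
      rw [GuidedRun, he]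
      exact ⟨h, .inl ⟨fun h => absurd h h1, rfl⟩, e3 c hce⟩

section Run

variable {U : Finset (Fin I.n)} {v : Fin I.n} {σ : (ℕ → ℕ) × ℕ}

theorem treatList_append (xs ys : List ℕ) :
    I.treatList c (xs ++ ys) σ = I.treatList c ys (I.treatList c xs σ) := by
  simp [treatList]

theorem GuidedRun.append_right {xs ys : List ℕ} (h : I.GuidedRun U v c (xs ++ ys) σ) :
    I.GuidedRun U v c ys (I.treatList c xs σ) := by
  induction xs generalizing σ with
  | nil => exact h
  | cons x xs ih => exact ih h.2.2

theorem GuidedRun.append_left {xs ys : List ℕ} (h : I.GuidedRun U v c (xs ++ ys) σ) :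
    I.GuidedRun U v c xs σ := by
  induction xs generalizing σ with
  | nil => trivial
  | cons x xs ih => exact ⟨h.1, h.2.1, ih h.2.2⟩

theorem GuidedRun.guided {xs : List ℕ} (h : I.GuidedRun U v c xs σ) (h0 : I.Guided U v σ) :
    I.Guided U v (I.treatList c xs σ) := by
  induction xs generalizing σ with
  | nil => exact h0
  | cons x xs ih => exact ih h.2.2 h.1

theorem GuidedRun.treatList_of_stable {xs : List ℕ} (h : I.GuidedRun U v c xs σ)
    (hs : ∀ x ∈ xs, I.Stable σ.1 x) : I.treatList c xs σ = σ := by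
  induction xs with
  | nil => rfl
  | cons x xs ih =>
    obtain ⟨-, h1, h2⟩ := h
    have he : I.treat c x σ = σ :=
      (h1.resolve_right fun h' => h'.1 (hs x List.mem_cons_self)).2
    rw [he] at h2
    have := ih h2 fun y hy => hs y (List.mem_cons_of_mem _ hy)
    rwa [treatList, List.foldl_cons, he]

/-- The first unstable vertex met gets a vertex decided; later treatments change nothing or decide
more. -/
theorem GuidedRun.progress {xs : List ℕ} (h : I.GuidedRun U v c xs σ) :
    (∀ x ∈ xs, I.Stable σ.1 x) ∨
      (I.labelSet (I.treatList c xs σ).1 0).card < (I.labelSet σ.1 0).card := by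
  induction xs generalizing σ with
  | nil => simp
  | cons x xs ih =>
    obtain ⟨-, h1, h2⟩ := h
    rw [treatList, List.foldl_cons, ← treatList]
    rcases h1 with ⟨h3, h4⟩ | ⟨h3, h4⟩
    · rw [h4] at h2 ⊢
      refine (ih h2).imp (fun h5 y hy => ?_) id
      rcases List.mem_cons.1 hy with rfl | hy
      · exact h3
      · exact h5 y hy
    · right
      rcases ih h2 with h5 | h5
      · rwa [h2.treatList_of_stable h5]
      · exact h5.trans h4

/-- A pass that decides nothing started from stable labels, and these are fixed by all further
passes. -/
theorem GuidedRun.stable_or_le {m : ℕ}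
    (h : I.GuidedRun U v c (List.replicate m (List.range I.n)).flatten σ) :
    (∀ x < I.n, I.Stable (I.treatList c (List.replicate m (List.range I.n)).flatten σ).1 x) ∨
      (I.labelSet (I.treatList c (List.replicate m (List.range I.n)).flatten σ).1 0).card + m ≤
        (I.labelSet σ.1 0).card := by
  induction m generalizing σ with
  | zero => exact .inr le_rfl
  | succ m ih =>
    rcases h.append_left (xs := List.range I.n).progress with h1 | h1
    · left
      rw [h.treatList_of_stable fun x hx => h1 x (List.mem_range.2 (mem_passes hx))]
      exact fun x hx => h1 x (List.mem_range.2 hx)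
    · rw [List.replicate_succ, List.flatten_cons, treatList_append]
      refine (ih h.append_right).imp id fun h2 => ?_
      omega

end Run

theorem exists_search_accepts {U : Finset (Fin I.n)} (hU : I.IsSolution U) :
    ∃ k < (I.d + 1) ^ I.t, ∃ v < I.n, I.Accepts (I.search (I.digit k) v) := by
  obtain ⟨⟨v, hv⟩⟩ := hU.1.nonempty
  have h0 : I.Guided U v (start v, 0) := by
    refine ⟨by simp [start], ?_, ?_, ?_, fun z => ?_⟩
    · dsimp only
      rw [labelSet_start]
      simpa using hv
    · intro y hy
      simp [mem_labelSet, start, Function.update_apply] at hy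
      split_ifs at hy
      omega
    · simp [labelSet, start, Function.update_apply, Finset.filter_eq_empty_iff]
      intro z
      split_ifs <;> simp
    · simp only [start, Function.update_apply]
      split_ifs <;> simp
  obtain ⟨e, e1, e2, e3⟩ := exists_guidedRun hU (List.replicate I.n (List.range I.n)).flatten
    (fun x => mem_passes) _ h0
  obtain ⟨k, hk, rfl⟩ := exists_digit_eq e1 e2
  have hrun := e3 (I.digit k) fun _ _ => rfl
  refine ⟨k, hk, v, v.2, ?_⟩
  have hg := hrun.guided h0
  have hst := hrun.stable_or_le
  rw [← search] at hg hst
  have hle := hg.le hU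
  set σ := I.search (I.digit k) v
  -- The start vertex is decided already, so fewer than `n` vertices are undecided and `n` passes
  -- cannot all make progress.
  replace hst := hst.resolve_right fun h => by
    have h1 : (I.labelSet (start v) 0).card < I.n := by
      conv_rhs => rw [← Fintype.card_fin I.n]
      exact Finset.card_lt_univ_of_notMem (x := v) (by simp [mem_labelSet, start])
    dsimp only at h
    omega
  obtain ⟨h1, h2, h3, h4, h5⟩ := hg
  -- Chosenness spreads along paths in `U`: a neighbor in `U` of a chosen vertex is neither removed,
  -- as it lies in `U`, nor undecided, by stability.
  have hall : U = I.labelSet σ.1 1 := by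
    refine (Finset.Subset.antisymm h2 fun x hx => ?_).symm
    have hr := hU.1.preconnected ⟨v, hv⟩ ⟨x, hx⟩
    rw [SimpleGraph.reachable_iff_reflTransGen] at hr
    rw [mem_labelSet]
    suffices ∀ z : (U : Set (Fin I.n)), Relation.ReflTransGen
        (I.G.induce (U : Set (Fin I.n))).Adj ⟨v, hv⟩ z → σ.1 z = 1 from this _ hr
    intro z hz
    induction hz with
    | refl => exact h1
    | tail _ hab ih =>
      rename_i a b _
      have hadj : I.G.Adj a b := hab
      have h6 : σ.1 b ≠ 2 := fun h6 => (mem_openNbhd.1 (h3 b (mem_labelSet.2 h6))).2 b.2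
      have h7 : σ.1 b ≠ 0 := fun h7 => by
        have := hst a a.1.2 ih
        rw [undecidedCount_eq, Finset.card_eq_zero] at this
        exact Finset.notMem_empty b.1 (this ▸ by simp [mem_labelSet, hadj, h7])
      have := h5 b
      omega
  refine ⟨?_, hle, ?_⟩
  · rw [defect_eq_zero]
    intro x hx
    rw [← undecidedCount_eq]
    refine ⟨hst x x.2 (mem_labelSet.1 hx), ?_⟩
    rw [← hall] at hx ⊢
    exact hU.card_neighbors hx
  · rw [chosenWeight_eq, ← hall]
    exact hU.2.2.2

/-! ### The running time and the final assembly -/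

/-- The right side is `4 * (t * d) ^ (2 * t)`. For `t ≥ 2` use `d + 1 ≤ t * d` and `t + 1 ≤ 2 ^ t ≤
(t * d) ^ t`; the factor `4` is needed for `t = d = 1`. -/
theorem pow_mul_le (t d : ℕ) (hd : 0 < d) :
    (((d + 1) ^ t * (t + 1) : ℕ) : ℝ) ≤
      4 * (2 : ℝ) ^ (2 * ((t : ℝ) * Real.logb 2 ((t : ℝ) * (d : ℝ)))) := by
  rcases Nat.eq_zero_or_pos t with rfl | ht
  · norm_num
  have htd : (0 : ℝ) < t * d := by positivity
  have key : (2 : ℝ) ^ (2 * ((t : ℝ) * Real.logb 2 ((t : ℝ) * (d : ℝ)))) =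
      (((t * d) ^ t * (t * d) ^ t : ℕ) : ℝ) := by
    rw [show 2 * ((t : ℝ) * Real.logb 2 ((t : ℝ) * (d : ℝ))) =
      Real.logb 2 ((t : ℝ) * (d : ℝ)) * ((2 * t : ℕ) : ℝ) by push_cast; ring,
      Real.rpow_mul (by norm_num), Real.rpow_logb (by norm_num) (by norm_num) htd,
      Real.rpow_natCast, two_mul, pow_add]
    push_cast
    rfl
  rw [key]
  norm_cast
  rcases Nat.lt_or_ge t 2 with h | h
  · obtain rfl : t = 1 := by omega
    simp only [one_mul, pow_one]
    nlinarith
  · have h1 : d + 1 ≤ t * d := by nlinarith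
    have h2 : t + 1 ≤ (t * d) ^ t :=
      calc t + 1 ≤ 2 ^ t := Nat.lt_two_pow_self
        _ ≤ _ := Nat.pow_le_pow_left (by nlinarith) t
    have h3 := Nat.mul_le_mul (Nat.pow_le_pow_left h1 t) h2
    omega

/-- The algorithm. -/
def solveProg : RAM.Program := initProg ;; loopProg

theorem run_solveProg : RAM.Run solveProg I.initialState fun k s =>
    k ≤ 216 * ((I.d + 1) ^ I.t * (I.t + 1)) * (I.n + 1) ^ 4 ∧ I.CorrectAnswer s := by
  refine RAM.run_seq.2 (run_initProg.mono ?_)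
  rintro k s ⟨hk, r, rfl, h1, h2⟩
  refine (run_loopProg r h1 h2).mono ?_
  rintro l s ⟨hl, r', S', c, rfl, hs⟩
  have hpos : 1 ≤ (I.d + 1) ^ I.t * (I.t + 1) := Nat.succ_le_of_lt (by positivity)
  have hn : I.n + 1 ≤ (I.n + 1) ^ 4 := Nat.le_self_pow (by norm_num) _
  have hm := Nat.mul_le_mul hpos hn
  refine ⟨by nlinarith, ?_⟩
  have hreg : (I.st r' S' c).reg 0 = r'.found := rfl
  rcases hs with ⟨hf, hs⟩ | ⟨hf, hs⟩
  · refine ⟨fun ⟨U, hU⟩ => ?_, fun _ => hf⟩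
    obtain ⟨k, hk, v, hv, ha⟩ := exists_search_accepts hU
    exact absurd ha (hs k hk v hv)
  · have hout : I.outputSet (I.st r' S' c) = I.labelSet S' 1 := by
      ext v
      simp [outputSet, labelSet, st, regs, memory_base v.2]
    refine ⟨fun _ => ⟨hf, ?_⟩, fun h => absurd ⟨_, hs.isSolution⟩ h⟩
    rw [hout]
    exact hs.isSolution

end CSRSInstance

theorem mainTheorem6 :
    ∃ (P : RAM.Program) (C : ℕ), ∀ I : CSRSInstance, ∃ (k : ℕ) (s : RAM.State),
      RAM.Exec P I.initialState k s ∧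
      I.CorrectAnswer s ∧
      (k : ℝ) ≤ C * (2 : ℝ) ^ ((C : ℝ) * ((I.t : ℝ) * Real.logb 2 ((I.t : ℝ) * (I.d : ℝ)))) *
        ((I.n : ℝ) + 1) ^ C := by
  -- The constant is `216 * 4`; in the two exponents `2` and `4` would suffice.
  refine ⟨CSRSInstance.solveProg, 864, fun I => ?_⟩
  obtain ⟨k, s, h1, h2, h3⟩ := I.run_solveProg
  refine ⟨k, s, h1, h3, ?_⟩
  -- Enlarging the coefficient in the exponent requires a nonnegative exponent, which holds since `t
  -- * d ≥ 1` for positive `t`.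
  have hL : 0 ≤ (I.t : ℝ) * Real.logb 2 ((I.t : ℝ) * (I.d : ℝ)) := by
    rcases Nat.eq_zero_or_pos I.t with ht | ht
    · simp [ht]
    · refine mul_nonneg (Nat.cast_nonneg _) (Real.logb_nonneg (by norm_num) ?_)
      exact_mod_cast Nat.mul_pos ht I.d_pos
  set L := (I.t : ℝ) * Real.logb 2 ((I.t : ℝ) * (I.d : ℝ))
  have hn : (1 : ℝ) ≤ (I.n : ℝ) + 1 := by linarith [Nat.cast_nonneg (α := ℝ) I.n]
  calc (k : ℝ) ≤ ((216 * ((I.d + 1) ^ I.t * (I.t + 1)) * (I.n + 1) ^ 4 : ℕ) : ℝ) := by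
        exact_mod_cast h2
    _ = 216 * (((I.d + 1) ^ I.t * (I.t + 1) : ℕ) : ℝ) * ((I.n : ℝ) + 1) ^ 4 := by push_cast; ring
    _ ≤ 216 * (4 * (2 : ℝ) ^ (2 * L)) * ((I.n : ℝ) + 1) ^ 4 := by
        gcongr
        exact CSRSInstance.pow_mul_le I.t I.d I.d_pos
    _ = 864 * (2 : ℝ) ^ (2 * L) * ((I.n : ℝ) + 1) ^ 4 := by ring
    _ ≤ 864 * (2 : ℝ) ^ (864 * L) * ((I.n : ℝ) + 1) ^ 864 := by
        gcongr
        · norm_num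
        · norm_num
        · norm_num
    _ = _ := by norm_num
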